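/- Let $G=(V,E)$ be a finite strongly connected digraph. Vertices $u\neq v$ are vertex-resilient if for every vertex $x\notin\{u,v\}$ they lie in the same strongly connected component of $G\setminus x$. A vertex-resilient block is a set $B\subseteq V$ with $|B|\ge 2$ that is maximal among the sets of pairwise vertex-resilient vertices. Notation. For a strongly connected digraph $D$ and a vertex $s$ of $D$, let $D^R$ be the reverse digraph and let $T$ be the dominator tree of the flow graph $D(s)$ (vertex $u$ dominates $w$ if every path from $s$ to $w$ contains $u$; the parent of $w\ne s$ in $T$ is the proper dominator of $w$ that is dominated by all proper dominators of $w$). Let $C(v)$ be the set of children of $v$ in $T$, $\hat C(v)=C(v)\cup\{v\}$, and let $C^k(r)$ be the set of descendants of $r$ exactly $k$ levels below $r$. For a non-leaf $r$ of $T$, the auxiliary graph $D_r$ (with respect to $D(s)$) has vertex set $C^0(r)\cup C^1(r)\cup C^2(r)\cup C^3(r)$ and is obtained from $D$ by contracting all vertices that are not descendants of $r$ into $r$, and, for each $w\in C^3(r)$, all descendants of $w$ into $w$ (no loops or parallel edges are kept). Its ordinary vertices are those of $C^1(r)\cup C^2(r)$, and also $s$ if $r=s$. For a set $B$, let $\mathit{split}(B,T)$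 be the family of the sets $B\cap\hat C(v)$, $v$ a vertex of $T$, that have at least two elements. For families $\mathcal B,\mathcal S$ of sets and a vertex $x$, let $\mathit{refine}(\mathcal B,\mathcal S,x)$ be the family of the sets $B\cap(S\cup\{x\})$, $B\in\mathcal B$, $S\in\mathcal S$, that have at least two elements. Algorithm FastVRB. Choose any $s\in V$ and start with the family $F$ of the blocks $\hat C(v)$, for all non-leaves $v$ of the dominator tree $D(s)$ of $G(s)$. Process the non-leaves $r$ of $D(s)$ in any bottom-up order (each vertex after all its proper descendants), as follows. Let $H=G_r$ be the auxiliary graph of $r$ with respect to $G(s)$, and let $T$ be the dominator tree of the flow graph $H^R(r)$. First replace in $F$ every block $B$ that contains a vertex of $C(r)$ (children in $D(s)$) by the members of $\mathit{split}(B,T)$. Then, for each non-leaf $q$ of $T$, in any order, let $H^R_q$ be the auxiliary graph of $q$ with respect to the flow graph $H^R(r)$, let $\mathcal B_q$ be the set of the blocks currently in $F$ that contain at least two ordinary vertices of $H^R_q$, let $\mathcal S$ be the set of strongly connected components of $H^R_q\setminus q$, and replace $\mathcal B_q$ in $F$ by $\mathit{refine}(\mathcal B_q,\mathcal S,q)$.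 The output is the final family $F$. Theorem (correctness of FastVRB). For every finite strongly connected digraph $G$ and every start vertex $s$, the algorithm has at least one execution, and every execution (for every admissible choice of the processing orders) outputs exactly the set of vertex-resilient blocks of $G$. -/

import Mathlib

/-- A digraph (parallel edges are not represented) whose vertices form a subset of the type `V`. -/
@[ext]
structure VDigraph (V : Type*) where
  verts : Set V
  Adj : V → V → Prop
  left_mem : ∀ {u v : V}, Adj u v → u ∈ verts
  right_mem : ∀ {u v : V}, Adj u v → v ∈ verts

namespace VDigraph

variable {V : Type*}

/-- A digraph on the whole type `V`. -/
def ofDigraph (G : Digraph V) : VDigraph V where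
  verts := Set.univ
  Adj := G.Adj
  left_mem _ := Set.mem_univ _
  right_mem _ := Set.mem_univ _

/-- The reverse digraph. -/
def reverse (D : VDigraph V) : VDigraph V where
  verts := D.verts
  Adj u v := D.Adj v u
  left_mem h := D.right_mem h
  right_mem h := D.left_mem h

/-- The digraph `D \ x` obtained by removing the vertex `x` and all edges incident to it. -/
def remove (D : VDigraph V) (x : V) : VDigraph V where
  verts := D.verts \ {x}
  Adj u v := D.Adj u v ∧ u ≠ x ∧ v ≠ x
  left_mem h := ⟨D.left_mem h.1, h.2.1⟩
  right_mem h := ⟨D.right_mem h.1, h.2.2⟩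

/-- `p` is the vertex sequence of a directed path of `D` from `u` to `v` (of length `0` if
`p = [u]` and `u = v`; repeated vertices are allowed). -/
def IsPath (D : VDigraph V) (p : List V) (u v : V) : Prop :=
  p.IsChain D.Adj ∧ p.head? = some u ∧ p.getLast? = some v ∧ ∀ x ∈ p, x ∈ D.verts

/-- `u` and `v` are vertices of `D` that lie in the same strongly connected component. -/
def SameSCC (D : VDigraph V) (u v : V) : Prop :=
  (∃ p, D.IsPath p u v) ∧ ∃ p, D.IsPath p v u

/-- `D` is strongly connected. -/
def StronglyConnected (D : VDigraph V) : Prop :=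
  ∀ u ∈ D.verts, ∀ v ∈ D.verts, D.SameSCC u v

/-- The set of the strongly connected components (as vertex sets) of `D`. -/
def sccs (D : VDigraph V) : Set (Set V) :=
  {S | ∃ v ∈ D.verts, S = {w | D.SameSCC v w}}

/-! ### Vertex-resilient blocks -/

/-- The removal of any vertex different from `u` and `v` leaves `u` and `v` in the same strongly
connected component. -/
def VertexResilient (D : VDigraph V) (u v : V) : Prop :=
  ∀ x ∈ D.verts, x ≠ u → x ≠ v → (D.remove x).SameSCC u v

/-- The set of (nontrivial) vertex-resilient blocks of `D`: the maximal sets of pairwise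
vertex-resilient vertices, except for the singletons. -/
def vrBlocks (D : VDigraph V) : Set (Set V) :=
  {B | Maximal (fun A : Set V => A ⊆ D.verts ∧ A.Pairwise D.VertexResilient) B ∧ B.Nontrivial}

/-! ### Dominator trees -/

/-- In the flow graph `D(s)`, `u` dominates `w`: every path from `s` to `w` contains `u`. -/
def Dominates (D : VDigraph V) (s u w : V) : Prop :=
  u ∈ D.verts ∧ w ∈ D.verts ∧ ∀ p, D.IsPath p s w → u ∈ p

/-- `v` is the immediate dominator of `w` in the flow graph `D(s)`, that is, the parent of `w` in
the dominator tree: `v` is a proper dominator of `w` that is dominated by all proper dominators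
of `w`. -/
def IsIDom (D : VDigraph V) (s v w : V) : Prop :=
  v ≠ w ∧ D.Dominates s v w ∧ ∀ u, u ≠ w → D.Dominates s u w → D.Dominates s u v

/-- The children `C(v)` of `v` in the dominator tree of `D(s)`. -/
def children (D : VDigraph V) (s v : V) : Set V := {w | D.IsIDom s v w}

/-- `Ĉ(v)`: the vertex `v` together with its children in the dominator tree of `D(s)`. -/
def closedChildren (D : VDigraph V) (s v : V) : Set V := insert v (D.children s v)

/-- The vertices that are not leaves of the dominator tree of `D(s)`. -/
def nonLeaves (D : VDigraph V) (s : V) : Set V := {v | (D.children s v).Nonempty}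

/-- `u` is an ancestor of `w` (and `w` a descendant of `u`), possibly `u = w`, in the dominator tree
of `D(s)`. -/
def IsAncestor (D : VDigraph V) (s u w : V) : Prop := Relation.ReflTransGen (D.IsIDom s) u w

/-- `C^k(r)`: the descendants of `r` that are `k` levels below `r` in the dominator tree
of `D(s)`. -/
def level (D : VDigraph V) (s r : V) : ℕ → Set V
  | 0 => {r}
  | k + 1 => {w | ∃ v ∈ level D s r k, w ∈ D.children s v}

/-! ### Auxiliary graphs -/

/-- The vertex set `C^0(r) ∪ C^1(r) ∪ C^2(r) ∪ C^3(r)` of the auxiliary graph of `r`. -/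
def auxVerts (D : VDigraph V) (s r : V) : Set V := {v | ∃ k ≤ 3, v ∈ D.level s r k}

/-- In the construction of the auxiliary graph of `r`, the vertex `x` of `D` becomes the vertex `y`:
a vertex of `auxVerts` is kept, a vertex that is not a descendant of `r` is contracted into `r`, and
a descendant of some `y ∈ C^3(r)` is contracted into `y`. -/
def ContractsTo (D : VDigraph V) (s r x y : V) : Prop :=
  (x ∈ D.auxVerts s r ∧ y = x) ∨ (¬ D.IsAncestor s r x ∧ y = r) ∨
    (y ∈ D.level s r 3 ∧ D.IsAncestor s y x)

theorem ContractsTo.mem {D : VDigraph V} {s r x y : V} (h : D.ContractsTo s r x y) :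
    y ∈ D.auxVerts s r := by
  rcases h with ⟨h, rfl⟩ | ⟨_, rfl⟩ | ⟨h, _⟩
  · exact h
  · exact ⟨0, by norm_num, rfl⟩
  · exact ⟨3, le_rfl, h⟩

/-- The auxiliary graph of `r` with respect to the flow graph `D(s)`, obtained from `D` by the
contractions described by `ContractsTo` (without keeping loops or parallel edges). -/
def auxGraph (D : VDigraph V) (s r : V) : VDigraph V where
  verts := D.auxVerts s r
  Adj a b := a ≠ b ∧ ∃ u v, D.Adj u v ∧ D.ContractsTo s r u a ∧ D.ContractsTo s r v b
  left_mem := by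
    rintro a b ⟨_, u, v, _, h, _⟩
    exact h.mem
  right_mem := by
    rintro a b ⟨_, u, v, _, _, h⟩
    exact h.mem

/-- The ordinary vertices of the auxiliary graph of `r` with respect to `D(s)`: the vertices in
`C^1(r) ∪ C^2(r)`, and also `s` itself if `r = s`. -/
def ordinary (D : VDigraph V) (s r : V) : Set V :=
  D.level s r 1 ∪ D.level s r 2 ∪ {v | v = s ∧ r = s}

end VDigraph

namespace FastVRB

variable {V : Type*}

/-- `refine(𝓑, 𝓢, x)`: replace each block `B ∈ 𝓑` by the sets `B ∩ (S ∪ {x})`, `S ∈ 𝓢`, that have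
at least two elements. -/
def refineBlocks (𝓑 𝓢 : Set (Set V)) (x : V) : Set (Set V) :=
  {A | ∃ B ∈ 𝓑, ∃ S ∈ 𝓢, A = B ∩ (S ∪ {x}) ∧ A.Nontrivial}

/-- `split(B, T)`, where `T` is the dominator tree of the flow graph `D(s)`: the sets `B ∩ Ĉ_T(v)`,
`v` a vertex of `T`, that have at least two elements. -/
def split (B : Set V) (D : VDigraph V) (s : V) : Set (Set V) :=
  {A | ∃ v ∈ D.verts, A = B ∩ D.closedChildren s v ∧ A.Nontrivial}

/-- Step 1: the initial set of blocks. -/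
def initialBlocks (D : VDigraph V) (s : V) : Set (Set V) :=
  {B | ∃ v ∈ D.nonLeaves s, B = D.closedChildren s v}

/-- Steps 3.1 to 3.3 for the auxiliary graph `H` of `r`: in the current set `F` of blocks, every
block that contains a vertex of `C(r)` is split by the dominator tree of the flow graph `H^R(r)`. -/
def splitStep (D : VDigraph V) (s r : V) (F : Set (Set V)) : Set (Set V) :=
  let H := D.auxGraph s r
  let 𝓑 := {B ∈ F | (B ∩ D.children s r).Nonempty}
  (F \ 𝓑) ∪ {A | ∃ B ∈ 𝓑, A ∈ split B H.reverse r}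

/-- Steps 3.5.1 to 3.5.3 for the second-level auxiliary graph `H^R_q` (the auxiliary graph of `q`
with respect to the flow graph `H^R(r)`, where `HR = H^R`): in the current set `F` of blocks, those
with at least two ordinary vertices of `H^R_q` are refined by the strongly connected components of
`H^R_q \ q`. -/
def refineStep (HR : VDigraph V) (r : V) (F : Set (Set V)) (q : V) : Set (Set V) :=
  let 𝓑 := {B ∈ F | (B ∩ HR.ordinary r q).Nontrivial}
  (F \ 𝓑) ∪ refineBlocks 𝓑 ((HR.auxGraph r q).remove q).sccs q

/-- One iteration of Step 3, for the auxiliary graph `H` of `r`; the list `qs` gives the order in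
which the second-level auxiliary graphs `H^R_q` are processed. -/
def process (D : VDigraph V) (s r : V) (qs : List V) (F : Set (Set V)) : Set (Set V) :=
  qs.foldl (refineStep (D.auxGraph s r).reverse r) (splitStep D s r F)

/-- The set of blocks at the end of the execution of the algorithm with start vertex `s`, where the
vertices `r` of Step 3 are processed in the order `rs` and, for each of them, the vertices `q` of
Step 3.5 are processed in the order `qs r`. -/
def run (D : VDigraph V) (s : V) (rs : List V) (qs : V → List V) : Set (Set V) :=
  rs.foldl (fun F r => process D s r (qs r) F) (initialBlocks D s)

/-- The list `l` enumerates the vertices that are not leaves of the dominator tree of `D(s)`. -/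
def EnumeratesNonLeaves (D : VDigraph V) (s : V) (l : List V) : Prop :=
  l.Nodup ∧ ∀ v, v ∈ l ↔ v ∈ D.nonLeaves s

/-- The list `l` is in bottom-up order with respect to the dominator tree of `D(s)`: a vertex is
never listed before one of its descendants. -/
def BottomUp (D : VDigraph V) (s : V) (l : List V) : Prop :=
  l.Pairwise fun a b => ¬ D.IsAncestor s a b

/-- Some execution of the algorithm on `D` with start vertex `s` outputs the set `O` of blocks. -/
def Outputs (D : VDigraph V) (s : V) (O : Set (Set V)) : Prop :=
  ∃ (rs : List V) (qs : V → List V),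
    EnumeratesNonLeaves D s rs ∧ BottomUp D s rs ∧
    (∀ r ∈ rs, EnumeratesNonLeaves (D.auxGraph s r).reverse r (qs r)) ∧
    O = run D s rs qs

end FastVRB

/-! Every set of pairwise vertex-resilient vertices lies in one `closedChildren` set of the
dominator tree (`exists_subset_closedChildren`): a vertex that properly dominates one member must
dominate every other member different from it. So the initial family covers all such sets, and
distinct members share at most one vertex. Both facts persist (`IsBlockFamily`), because
vertex-resilience passes to auxiliary graphs and their reverses. It remains to show that vertices
left together at the end are vertex-resilient.

Walks avoiding a vertex of an auxiliary graph transfer to it (`Conn.auxGraph_ne`) and lift back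
avoiding any vertex contracted into the avoided one (`Conn.of_auxGraph_ne`). Hence a pair of
ordinary vertices of H = G_r may be tested inside H (`VertexResilient.of_auxGraph`).

Let a, b be such a pair in one block after r is processed, and remove x from H. If x dominates a or
b in H^R(r), the second-level refinements keep a and b strongly connected (`sameSCC_of_refinedAt`).
Otherwise both reach r avoiding x. If x dominates neither in D(s), r also reaches both, which closes
the case. If x dominates one of them in D(s), depths force a and b to be siblings below a proper
descendant of r, where the bottom-up order has already settled them. This is
`IsBlockFamily.resolved_of_refinedAt`. Once all non-leaves are settled, covering and small
intersections give maximality (`IsBlockFamily.eq_vrBlocks`). -/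

namespace VDigraph

variable {V : Type*}

/-! ### Walks within a set of vertices -/

/-- There is a walk of `D` from `u` to `w` all of whose vertices satisfy `P`. -/
def Conn (D : VDigraph V) (P : V → Prop) (u w : V) : Prop :=
  (u ∈ D.verts ∧ P u) ∧ Relation.ReflTransGen (fun a b => D.Adj a b ∧ P b) u w

namespace Conn

variable {D : VDigraph V} {P Q : V → Prop} {u v w : V}

theorem refl (hu : u ∈ D.verts) (h : P u) : D.Conn P u u := ⟨⟨hu, h⟩, .refl⟩

theorem tail (h : D.Conn P u v) (hvw : D.Adj v w) (hw : P w) : D.Conn P u w :=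
  ⟨h.1, h.2.tail ⟨hvw, hw⟩⟩

theorem trans (h : D.Conn P u v) (h' : D.Conn P v w) : D.Conn P u w := ⟨h.1, h.2.trans h'.2⟩

theorem head (huv : D.Adj u v) (hu : P u) (h : D.Conn P v w) : D.Conn P u w :=
  ⟨⟨D.left_mem huv, hu⟩, .head ⟨huv, h.1.2⟩ h.2⟩

/-- Induction on the last vertex of a walk. -/
theorem induction_right {motive : V → Prop} (h : D.Conn P u w)
    (refl : u ∈ D.verts → P u → motive u)
    (tail : ∀ a b, D.Conn P u a → D.Adj a b → P b → motive a → motive b) : motive w := by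
  obtain ⟨hu, h⟩ := h
  induction h with
  | refl => exact refl hu.1 hu.2
  | tail h₁ h₂ ih => exact tail _ _ ⟨hu, h₁⟩ h₂.1 h₂.2 ih

theorem right (h : D.Conn P u w) : w ∈ D.verts ∧ P w :=
  h.induction_right (motive := fun w => w ∈ D.verts ∧ P w) (fun h₁ h₂ => ⟨h₁, h₂⟩)
    fun _ _ _ h₁ h₂ _ => ⟨D.right_mem h₁, h₂⟩

/-- Induction on the first vertex of a walk. -/
theorem induction_left {motive : V → Prop} (h : D.Conn P u w)
    (refl : w ∈ D.verts → P w → motive w)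
    (head : ∀ a b, D.Adj a b → P a → D.Conn P b w → motive b → motive a) : motive u := by
  have hw := h.right
  obtain ⟨hu, h⟩ := h
  suffices H : P u → motive u from H hu.2
  have : P u → motive u ∧ D.Conn P u w := by
    clear hu
    induction h using Relation.ReflTransGen.head_induction_on with
    | refl => exact fun _ => ⟨refl hw.1 hw.2, .refl hw.1 hw.2⟩
    | head h₁ _ ih =>
      intro ha
      obtain ⟨h₂, h₃⟩ := ih h₁.2
      exact ⟨head _ _ h₁.1 ha h₃ h₂, .head h₁.1 ha h₃⟩
  exact fun h => (this h).1

theorem mono (h : D.Conn P u w) (hPQ : ∀ z ∈ D.verts, P z → Q z) : D.Conn Q u w :=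
  h.induction_right (fun h₁ h₂ => .refl h₁ (hPQ _ h₁ h₂))
    fun _ _ _ h₁ h₂ ih => ih.tail h₁ (hPQ _ (D.right_mem h₁) h₂)

theorem reverse (h : D.Conn P u w) : D.reverse.Conn P w u :=
  h.induction_left (fun h₁ h₂ => .refl h₁ h₂) fun a _ h₁ h₂ _ ih => ih.tail (w := a) h₁ h₂

theorem remove {x : V} (h : D.Conn (fun z => P z ∧ z ≠ x) u w) : (D.remove x).Conn P u w :=
  h.induction_right (fun h₁ h₂ => .refl ⟨h₁, h₂.2⟩ h₂.1)
    fun _ _ h₀ h₁ h₂ ih => ih.tail ⟨h₁, h₀.right.2.2, h₂.2⟩ h₂.1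

theorem of_remove {x : V} (h : (D.remove x).Conn P u w) : D.Conn (fun z => P z ∧ z ≠ x) u w :=
  h.induction_right (fun h₁ h₂ => .refl h₁.1 ⟨h₂, h₁.2⟩)
    fun _ _ _ h₁ h₂ ih => ih.tail h₁.1 ⟨h₂, h₁.2.2⟩

end Conn

theorem exists_isPath_iff (D : VDigraph V) (P : V → Prop) (u w : V) :
    (∃ p, D.IsPath p u w ∧ ∀ x ∈ p, P x) ↔ D.Conn P u w := by
  constructor
  · rintro ⟨p, ⟨hc, hh, hl, hm⟩, hP⟩
    induction p generalizing u with
    | nil => simp at hh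
    | cons a t ih =>
      obtain rfl : a = u := by simpa using hh
      cases t with
      | nil =>
        obtain rfl : a = w := by simpa using hl
        exact .refl (hm a (by simp)) (hP a (by simp))
      | cons b t =>
        rw [List.isChain_cons_cons] at hc
        refine .head hc.1 (hP a (by simp)) (ih b ?_ hc.2 rfl ?_ ?_)
        · exact fun x hx => hP x (List.mem_cons_of_mem _ hx)
        · simpa using hl
        · exact fun x hx => hm x (List.mem_cons_of_mem _ hx)
  · intro h
    refine h.induction_left (motive := fun u => ∃ p, D.IsPath p u w ∧ ∀ x ∈ p, P x) ?_ ?_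
    · exact fun h₁ h₂ => ⟨[w], ⟨by simp, by simp, by simp, by simpa using h₁⟩, by simpa using h₂⟩
    · rintro a b h₁ h₂ - ⟨p, ⟨hc, hh, hl, hm⟩, hP⟩
      cases p with
      | nil => simp at hh
      | cons c t =>
        obtain rfl : c = b := by simpa using hh
        refine ⟨a :: c :: t, ⟨?_, by simp, ?_, ?_⟩, ?_⟩
        · exact List.isChain_cons_cons.2 ⟨h₁, hc⟩
        · simpa using hl
        · exact List.forall_mem_cons.2 ⟨D.left_mem h₁, hm⟩
        · exact List.forall_mem_cons.2 ⟨h₂, hP⟩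

theorem sameSCC_iff {D : VDigraph V} {u w : V} :
    D.SameSCC u w ↔ D.Conn (fun _ => True) u w ∧ D.Conn (fun _ => True) w u := by
  simp [SameSCC, ← exists_isPath_iff]

theorem sameSCC_remove_iff {D : VDigraph V} {x u w : V} :
    (D.remove x).SameSCC u w ↔ D.Conn (· ≠ x) u w ∧ D.Conn (· ≠ x) w u := by
  rw [sameSCC_iff]
  constructor
  · rintro ⟨h₁, h₂⟩
    exact ⟨h₁.of_remove.mono fun _ _ h => h.2, h₂.of_remove.mono fun _ _ h => h.2⟩
  · rintro ⟨h₁, h₂⟩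
    exact ⟨(h₁.mono fun _ _ h => ⟨trivial, h⟩).remove, (h₂.mono fun _ _ h => ⟨trivial, h⟩).remove⟩

/-- Path lists disappear here: all later dominator arguments build or exclude a walk avoiding a
vertex. -/
theorem dominates_iff {D : VDigraph V} {s u w : V} :
    D.Dominates s u w ↔ u ∈ D.verts ∧ w ∈ D.verts ∧ ¬ D.Conn (· ≠ u) s w := by
  rw [Dominates, ← exists_isPath_iff]
  refine and_congr_right fun _ => and_congr_right fun _ => ?_
  push Not
  refine forall_congr' fun p => forall_congr' fun _ => ?_
  constructor
  · exact fun h => ⟨u, h, rfl⟩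
  · rintro ⟨x, h, rfl⟩
    exact h

theorem StronglyConnected.conn {D : VDigraph V} (hD : D.StronglyConnected) {u w : V}
    (hu : u ∈ D.verts) (hw : w ∈ D.verts) : D.Conn (fun _ => True) u w :=
  (sameSCC_iff.1 (hD u hu w hw)).1

theorem StronglyConnected.of_conn {D : VDigraph V}
    (h : ∀ u ∈ D.verts, ∀ w ∈ D.verts, D.Conn (fun _ => True) u w) : D.StronglyConnected :=
  fun u hu w hw => sameSCC_iff.2 ⟨h u hu w hw, h w hw u hu⟩

theorem StronglyConnected.reverse {D : VDigraph V} (hD : D.StronglyConnected) :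
    D.reverse.StronglyConnected :=
  .of_conn fun _ hu _ hw => (hD.conn (D := D) hw hu).reverse

theorem sameSCC_remove_reverse {D : VDigraph V} {x u w : V} :
    (D.reverse.remove x).SameSCC u w ↔ (D.remove x).SameSCC u w := by
  rw [sameSCC_remove_iff, sameSCC_remove_iff]
  exact ⟨fun h => ⟨h.2.reverse, h.1.reverse⟩, fun h => ⟨h.2.reverse, h.1.reverse⟩⟩

theorem VertexResilient.reverse {D : VDigraph V} {u w : V} (h : D.VertexResilient u w) :
    D.reverse.VertexResilient u w :=
  fun x hx h₁ h₂ => sameSCC_remove_reverse.2 (h x hx h₁ h₂)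

/-! ### Dominators -/

namespace Dominates

variable {D : VDigraph V} {s u v w : V}

theorem left_mem (h : D.Dominates s u w) : u ∈ D.verts := h.1

theorem right_mem (h : D.Dominates s u w) : w ∈ D.verts := h.2.1

theorem not_conn (h : D.Dominates s u w) : ¬ D.Conn (· ≠ u) s w := (dominates_iff.1 h).2.2

theorem refl (h : u ∈ D.verts) : D.Dominates s u u :=
  dominates_iff.2 ⟨h, h, fun h' => h'.right.2 rfl⟩

theorem root (hs : s ∈ D.verts) (h : w ∈ D.verts) : D.Dominates s s w :=
  dominates_iff.2 ⟨hs, h, fun h' => h'.1.2 rfl⟩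

theorem eq_root (h : D.Dominates s u s) : u = s := by
  by_contra hne
  exact h.not_conn (.refl h.2.1 (Ne.symm hne))

/-- A walk from the root to `w` passes through every dominator of `w`. -/
theorem conn {P : V → Prop} (h : D.Dominates s v w) (hw : D.Conn P s w) :
    D.Conn P s v ∧ D.Conn P v w := by
  have key : D.Conn (· ≠ v) s w ∨ D.Conn P s v ∧ D.Conn P v w := by
    refine hw.induction_right
      (motive := fun w => D.Conn (· ≠ v) s w ∨ D.Conn P s v ∧ D.Conn P v w) ?_ ?_
    · intro h₁ h₂
      by_cases hsv : s = v
      · exact hsv ▸ .inr ⟨.refl h₁ h₂, .refl h₁ h₂⟩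
      · exact .inl (.refl h₁ hsv)
    · intro a b h₀ h₁ h₂ ih
      by_cases hb : b = v
      · exact hb ▸ .inr ⟨h₀.tail h₁ h₂, .refl (D.right_mem h₁) h₂⟩
      · exact ih.imp (fun h => h.tail h₁ hb) fun h => ⟨h.1, h.2.tail h₁ h₂⟩
  exact key.resolve_left h.not_conn

theorem trans (h : D.Dominates s u v) (h' : D.Dominates s v w) : D.Dominates s u w :=
  dominates_iff.2 ⟨h.1, h'.2.1, fun hc => h.not_conn (h'.conn hc).1⟩

/-- An edge enters the set of the vertices dominated by `w` only at `w`. -/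
theorem of_adj (h : D.Dominates s w v) (huv : D.Adj u v) (hne : w ≠ v) : D.Dominates s w u :=
  dominates_iff.2 ⟨h.1, D.left_mem huv, fun hc => h.not_conn (hc.tail huv hne.symm)⟩

end Dominates

/-- A vertex not dominated by `r` reaches `r` through vertices not dominated by `r`. -/
theorem conn_of_not_dominates {D : VDigraph V} {s v r : V}
    (hD : D.StronglyConnected) (hr : r ∈ D.verts) (hv : v ∈ D.verts)
    (h : ¬ D.Dominates s r v) : D.Conn (fun z => z = r ∨ ¬ D.Dominates s r z) v r := by
  have key : D.Conn (fun z => z = r ∨ ¬ D.Dominates s r z) v r ∨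
      D.Conn (fun z => ¬ D.Dominates s r z) v r := by
    refine (hD.conn hv hr).induction_right (motive := fun y =>
      D.Conn (fun z => z = r ∨ ¬ D.Dominates s r z) v r ∨
        D.Conn (fun z => ¬ D.Dominates s r z) v y) (fun _ _ => .inr (.refl hv h)) ?_
    rintro a b - h₁ - (ih | ih)
    · exact .inl ih
    by_cases hb : b = r
    · subst hb
      exact .inl ((ih.mono fun _ _ h => .inr h).tail h₁ (.inl rfl))
    · exact .inr (ih.tail h₁ fun h' => ih.right.2 (h'.of_adj h₁ (Ne.symm hb)))
  exact key.elim id fun h => h.mono fun _ _ => .inr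

section

variable {D : VDigraph V} {s u v w : V} (hs : s ∈ D.verts) (hD : D.StronglyConnected)

include hs hD

/-- On a walk from the root, whichever of the two vertices comes first is reached without the other.
-/
theorem Dominates.antisymm (h : D.Dominates s u v) (h' : D.Dominates s v u) : u = v := by
  by_contra hne
  have key : D.Conn (fun z => z ≠ u ∧ z ≠ v) s u ∨ D.Conn (· ≠ u) s v ∨ D.Conn (· ≠ v) s u := by
    refine (hD.conn hs h.1).induction_right (motive := fun z =>
      D.Conn (fun z => z ≠ u ∧ z ≠ v) s z ∨ D.Conn (· ≠ u) s v ∨ D.Conn (· ≠ v) s u) ?_ ?_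
    · intro _ _
      by_cases h₁ : s = u
      · subst h₁
        exact .inr (.inr (.refl hs hne))
      by_cases h₂ : s = v
      · subst h₂
        exact .inr (.inl (.refl hs (Ne.symm hne)))
      exact .inl (.refl hs ⟨h₁, h₂⟩)
    · rintro a b - h₁ - (ih | ih)
      · by_cases hbu : b = u
        · subst hbu
          exact .inr (.inr ((ih.mono fun _ _ h => h.2).tail h₁ hne))
        by_cases hbv : b = v
        · subst hbv
          exact .inr (.inl ((ih.mono fun _ _ h => h.1).tail h₁ (Ne.symm hne)))
        exact .inl (ih.tail h₁ ⟨hbu, hbv⟩)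
      · exact .inr ih
  rcases key with h₁ | h₁ | h₁
  · exact h₁.right.2.1 rfl
  · exact h.not_conn h₁
  · exact h'.not_conn h₁

/-- If neither dominates the other, each is reachable avoiding the other. Along a walk to `w`, each
visit to `u` or `v` can be replaced by such a walk, so `w` is reached avoiding one of them. -/
theorem Dominates.total (h : D.Dominates s u w) (h' : D.Dominates s v w) :
    D.Dominates s u v ∨ D.Dominates s v u := by
  by_contra! hcon
  have hu : D.Conn (· ≠ u) s v := by
    by_contra hc
    exact hcon.1 (dominates_iff.2 ⟨h.1, h'.1, hc⟩)
  have hv : D.Conn (· ≠ v) s u := by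
    by_contra hc
    exact hcon.2 (dominates_iff.2 ⟨h'.1, h.1, hc⟩)
  have key : D.Conn (· ≠ u) s w ∨ D.Conn (· ≠ v) s w := by
    refine (hD.conn hs h.2.1).induction_right
      (motive := fun z => D.Conn (· ≠ u) s z ∨ D.Conn (· ≠ v) s z) ?_ ?_
    · exact fun _ _ => .inl (.refl hs hu.1.2)
    · rintro a b - h₁ - ih
      by_cases hbu : b = u
      · exact .inr (hbu ▸ hv)
      by_cases hbv : b = v
      · exact .inl (hbv ▸ hu)
      exact ih.imp (fun h => h.tail h₁ hbu) fun h => h.tail h₁ hbv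
  exact key.elim h.not_conn h'.not_conn

/-- A dominator of `u` is connected to `u` within the set of the vertices that it dominates. -/
theorem Dominates.conn_within (h : D.Dominates s w u) : D.Conn (D.Dominates s w) w u := by
  have key : D.Conn (· ≠ w) s u ∨ D.Conn (D.Dominates s w) w u := by
    refine (hD.conn hs h.2.1).induction_right
      (motive := fun z => D.Conn (· ≠ w) s z ∨ D.Conn (D.Dominates s w) w z) ?_ ?_
    · intro _ _
      by_cases hsw : s = w
      · subst hsw
        exact .inr (.refl hs (.refl hs))
      · exact .inl (.refl hs hsw)
    · intro a b _ h₁ _ ih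
      have hb := D.right_mem h₁
      by_cases hbw : b = w
      · exact .inr (hbw ▸ .refl hb (.refl hb))
      rcases ih with ih | ih
      · exact .inl (ih.tail h₁ hbw)
      · by_cases hc : D.Conn (· ≠ w) s b
        · exact .inl hc
        · exact .inr (ih.tail h₁ (dominates_iff.2 ⟨h.1, hb, hc⟩))
  exact key.resolve_left h.not_conn

end

/-! ### The dominator tree -/

/-- The number of dominators of `w`. -/
noncomputable def depth (D : VDigraph V) (s w : V) : ℕ := {u | D.Dominates s u w}.ncard

theorem IsIDom.ne {D : VDigraph V} {s v w : V} (h : D.IsIDom s v w) : v ≠ w := h.1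

theorem IsIDom.dominates {D : VDigraph V} {s v w : V} (h : D.IsIDom s v w) : D.Dominates s v w :=
  h.2.1

theorem IsIDom.of_dominates {D : VDigraph V} {s u v w : V} (h : D.IsIDom s v w)
    (hu : D.Dominates s u w) (hne : u ≠ w) : D.Dominates s u v := h.2.2 u hne hu

theorem IsIDom.ne_root {D : VDigraph V} {s v w : V} (h : D.IsIDom s v w) : w ≠ s := by
  rintro rfl
  exact h.ne h.dominates.eq_root

theorem IsIDom.unique {D : VDigraph V} {s u v w : V} (hs : s ∈ D.verts)
    (hD : D.StronglyConnected) (h : D.IsIDom s u w) (h' : D.IsIDom s v w) :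
    u = v :=
  (h'.of_dominates h.dominates h.ne).antisymm hs hD (h.of_dominates h'.dominates h'.ne)

section

variable [Finite V] {D : VDigraph V} {s u v w : V} (hs : s ∈ D.verts) (hD : D.StronglyConnected)

include hs hD

theorem Dominates.depth_lt (h : D.Dominates s u w) (hne : u ≠ w) : D.depth s u < D.depth s w := by
  refine Set.ncard_lt_ncard (Set.ssubset_iff_of_subset (fun z hz => Dominates.trans hz h) |>.2
    ⟨w, Dominates.refl h.2.1, fun h' => hne (h.antisymm hs hD h')⟩) (Set.toFinite _)

theorem Dominates.depth_le (h : D.Dominates s u w) : D.depth s u ≤ D.depth s w := by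
  by_cases hne : u = w
  · rw [hne]
  · exact (h.depth_lt hs hD hne).le

theorem Dominates.eq_of_depth_le (h : D.Dominates s u w) (hle : D.depth s w ≤ D.depth s u) :
    u = w := by
  by_contra hne
  exact (h.depth_lt hs hD hne).not_ge hle

/-- The dominators of `w` form a chain, so the deepest proper one is the parent. -/
theorem exists_isIDom (hw : w ∈ D.verts) (hne : w ≠ s) : ∃ v, D.IsIDom s v w := by
  obtain ⟨v, hv, hmax⟩ := Set.exists_max_image {u | u ≠ w ∧ D.Dominates s u w} (D.depth s)
    (Set.toFinite _) ⟨s, hne.symm, .root hs hw⟩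
  refine ⟨v, hv.1, hv.2, fun u hu hd => ?_⟩
  refine (hd.total hs hD hv.2).elim id fun h => ?_
  rw [h.eq_of_depth_le hs hD (hmax u ⟨hu, hd⟩)]
  exact .refl hd.1

theorem IsIDom.depth_eq (h : D.IsIDom s v w) : D.depth s w = D.depth s v + 1 := by
  have : {u | D.Dominates s u w} = insert w {u | D.Dominates s u v} := by
    ext u
    simp only [Set.mem_ofPred_eq, Set.mem_insert_iff]
    constructor
    · intro hu
      by_cases hne : u = w
      · exact .inl hne
      · exact .inr (h.of_dominates hu hne)
    · rintro (rfl | hu)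
      · exact .refl h.dominates.2.1
      · exact hu.trans h.dominates
  rw [depth, this, Set.ncard_insert_of_notMem _ (Set.toFinite _)]
  · rfl
  · exact fun h' => h.ne (h.dominates.antisymm hs hD h')

theorem isAncestor_iff (hw : w ∈ D.verts) : D.IsAncestor s u w ↔ D.Dominates s u w := by
  constructor
  · intro h
    induction h with
    | refl => exact .refl hw
    | tail _ h₂ ih => exact (ih h₂.dominates.1).trans h₂.dominates
  · intro h
    induction hn : D.depth s w generalizing w with
    | zero => 
      by_cases hne : u = w
      · exact hne ▸ .refl
      · have := h.depth_lt hs hD hne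
        omega
    | succ n ih =>
      by_cases hne : u = w
      · exact hne ▸ .refl
      obtain ⟨v, hv⟩ := exists_isIDom hs hD hw fun hws => hne (by subst hws; exact h.eq_root)
      have := hv.depth_eq hs hD
      exact (ih hv.dominates.1 (hv.of_dominates h hne) (by omega)).tail hv

/-- Turns tree levels into depth equations, so that later case distinctions become arithmetic. -/
theorem mem_level_iff {r : V} (hr : r ∈ D.verts) {k : ℕ} :
    w ∈ D.level s r k ↔ D.Dominates s r w ∧ D.depth s w = D.depth s r + k := by
  induction k generalizing w with
  | zero =>
    simp only [level, Set.mem_singleton_iff]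
    constructor
    · rintro rfl
      exact ⟨.refl hr, rfl⟩
    · rintro ⟨h, h'⟩
      exact (h.eq_of_depth_le hs hD h'.le).symm
  | succ k ih =>
    simp only [level, Set.mem_ofPred_eq, ih, children]
    constructor
    · rintro ⟨v, ⟨h₁, h₂⟩, h⟩
      have := h.depth_eq hs hD
      exact ⟨h₁.trans h.dominates, by omega⟩
    · rintro ⟨h, h'⟩
      have hne : r ≠ w := by
        rintro rfl
        omega
      obtain ⟨v, hv⟩ := exists_isIDom hs hD h.2.1 fun hws => hne (by subst hws; exact h.eq_root)
      have := hv.depth_eq hs hD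
      exact ⟨v, ⟨hv.of_dominates h hne, by omega⟩, hv⟩

theorem mem_auxVerts_iff {r : V} (hr : r ∈ D.verts) :
    w ∈ D.auxVerts s r ↔ D.Dominates s r w ∧ D.depth s w ≤ D.depth s r + 3 := by
  simp only [auxVerts, Set.mem_ofPred_eq, mem_level_iff hs hD hr]
  constructor
  · rintro ⟨k, hk, h, h'⟩
    exact ⟨h, by omega⟩
  · rintro ⟨h, h'⟩
    have := h.depth_le hs hD
    exact ⟨D.depth s w - D.depth s r, by omega, h, by omega⟩

theorem mem_ordinary_iff {r : V} (hr : r ∈ D.verts) :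
    w ∈ D.ordinary s r ↔ D.Dominates s r w ∧
      (D.depth s w = D.depth s r + 1 ∨ D.depth s w = D.depth s r + 2 ∨ w = s ∧ r = s) := by
  simp only [ordinary, Set.mem_union, mem_level_iff hs hD hr, Set.mem_ofPred_eq]
  constructor
  · rintro ((h | h) | h)
    · exact ⟨h.1, .inl h.2⟩
    · exact ⟨h.1, .inr (.inl h.2)⟩
    · exact ⟨by rw [h.1, h.2]; exact .refl hs, .inr (.inr h)⟩
  · rintro ⟨h, h' | h' | h'⟩
    · exact .inl (.inl ⟨h, h'⟩)
    · exact .inl (.inr ⟨h, h'⟩)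
    · exact .inr h'

theorem Dominates.exists_depth_eq (h : D.Dominates s u w) {n : ℕ} (hn : D.depth s u ≤ n)
    (hn' : n ≤ D.depth s w) : ∃ v, D.Dominates s u v ∧ D.Dominates s v w ∧ D.depth s v = n := by
  obtain ⟨k, hk⟩ := Nat.exists_eq_add_of_le hn'
  induction k generalizing w with
  | zero => exact ⟨w, h, .refl h.2.1, by omega⟩
  | succ k ih =>
    have hne : u ≠ w := by
      rintro rfl
      omega
    obtain ⟨v, hv⟩ := exists_isIDom hs hD h.2.1 fun hws => hne (by subst hws; exact h.eq_root)
    have := hv.depth_eq hs hD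
    obtain ⟨x, h₁, h₂, h₃⟩ := ih (hv.of_dominates h hne) (by omega) (by omega)
    exact ⟨x, h₁, h₂.trans hv.dominates, h₃⟩

theorem Dominates.eq_of_depth_eq (h : D.Dominates s u w) (h' : D.Dominates s v w)
    (hd : D.depth s u = D.depth s v) : u = v :=
  (h.total hs hD h').elim (fun h => h.eq_of_depth_le hs hD hd.ge)
    fun h => (h.eq_of_depth_le hs hD hd.le).symm

/-- Two closed sets of children share at most one vertex. -/
theorem eq_of_nontrivial_inter_closedChildren
    (h : (D.closedChildren s u ∩ D.closedChildren s v).Nontrivial) : u = v := by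
  obtain ⟨a, ha, b, hb, hab⟩ := h
  simp only [closedChildren, children, Set.mem_inter_iff, Set.mem_insert_iff,
    Set.mem_ofPred_eq] at ha hb
  by_contra hne
  rcases ha with ⟨rfl | ha, rfl | ha'⟩
  · exact hne rfl
  · rcases hb with ⟨rfl | hb, rfl | hb'⟩
    · exact hab rfl
    · exact hab rfl
    · have h₁ := ha'.depth_eq hs hD
      have h₂ := hb.depth_eq hs hD
      omega
    · exact hne (hb.unique hs hD hb')
  · rcases hb with ⟨rfl | hb, rfl | hb'⟩
    · exact hne rfl
    · have h₁ := ha.depth_eq hs hD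
      have h₂ := hb'.depth_eq hs hD
      omega
    · exact hab rfl
    · exact hne (hb.unique hs hD hb')
  · exact hne (ha.unique hs hD ha')

/-- A set of pairwise vertex-resilient vertices lies in some closed set of children. -/
theorem exists_subset_closedChildren {C : Set V} (hC : C ⊆ D.verts) (hnt : C.Nontrivial)
    (hvr : C.Pairwise D.VertexResilient) : ∃ p ∈ D.nonLeaves s, C ⊆ D.closedChildren s p := by
  -- The parent of a deepest member is the required vertex.
  obtain ⟨c, hc, hmax⟩ := Set.exists_max_image C (D.depth s) (Set.toFinite _) hnt.nonempty
  have hcs : c ≠ s := by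
    rintro rfl
    obtain ⟨b, hb, hbc⟩ := hnt.exists_ne c
    exact hbc ((Dominates.root hs (hC hb)).eq_of_depth_le hs hD (hmax b hb)).symm
  obtain ⟨p, hp⟩ := exists_isIDom hs hD (hC hc) hcs
  refine ⟨p, ⟨c, hp⟩, fun b hb => ?_⟩
  have transfer : ∀ {a b x}, a ∈ C → b ∈ C → x ≠ a → x ≠ b → D.Dominates s x a →
      D.Dominates s x b := by
    intro a b x ha hb hxa hxb h
    by_cases hab : a = b
    · exact hab ▸ h
    refine dominates_iff.2 ⟨h.1, hC hb, fun hc => h.not_conn (hc.trans ?_)⟩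
    exact (sameSCC_remove_iff.1 (hvr ha hb hab x h.1 hxa hxb)).2
  by_cases hbp : b = p
  · exact .inl hbp
  by_cases hbc : b = c
  · exact .inr (hbc ▸ hp)
  have hpb := transfer hc hb hp.ne (Ne.symm hbp) hp.dominates
  obtain ⟨p', hp'⟩ := exists_isIDom hs hD (hC hb) fun hbs =>
    hbp (by subst hbs; exact hpb.eq_root.symm)
  have hdep := hp'.depth_eq hs hD
  -- By the choice of `c`, it is not shallower than `b`, so it cannot be the parent of `b`. Then `p`
  -- and `p'` dominate each other.
  have hp'c : p' ≠ c := by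
    rintro rfl
    have := hmax b hb
    omega
  have h₁ := hp.of_dominates (transfer hb hc hp'.ne hp'c hp'.dominates) hp'c
  have h₂ := hp'.of_dominates hpb (Ne.symm hbp)
  exact .inr (h₂.antisymm hs hD h₁ ▸ hp')

end

/-! ### Auxiliary graphs -/

theorem contractsTo_self {D : VDigraph V} {s r x : V} (hx : x ∈ D.auxVerts s r) :
    D.ContractsTo s r x x :=
  .inl ⟨hx, rfl⟩

section

variable [Finite V] {D : VDigraph V} {s r : V} (hs : s ∈ D.verts) (hD : D.StronglyConnected)
  (hr : r ∈ D.verts)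

include hs hD hr

theorem auxVerts_subset : D.auxVerts s r ⊆ D.verts :=
  fun _ hx => ((mem_auxVerts_iff hs hD hr).1 hx).1.2.1

theorem root_mem_auxVerts : r ∈ D.auxVerts s r :=
  (mem_auxVerts_iff hs hD hr).2 ⟨.refl hr, by omega⟩

theorem ordinary_subset_auxVerts : D.ordinary s r ⊆ D.auxVerts s r := by
  intro x hx
  obtain ⟨h, h'⟩ := (mem_ordinary_iff hs hD hr).1 hx
  refine (mem_auxVerts_iff hs hD hr).2 ⟨h, ?_⟩
  rcases h' with h' | h' | ⟨rfl, rfl⟩ <;> omega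

theorem contractsTo_iff {x y : V} (hx : x ∈ D.verts) :
    D.ContractsTo s r x y ↔
      (D.Dominates s r x ∧ D.depth s x ≤ D.depth s r + 3 ∧ y = x) ∨
      (¬ D.Dominates s r x ∧ y = r) ∨
      (D.Dominates s r y ∧ D.depth s y = D.depth s r + 3 ∧ D.Dominates s y x) := by
  rw [ContractsTo, mem_auxVerts_iff hs hD hr, isAncestor_iff hs hD hx, isAncestor_iff hs hD hx,
    mem_level_iff hs hD hr]
  tauto

theorem contractsTo_of_not_dominates {x : V} (hx : x ∈ D.verts) (h : ¬ D.Dominates s r x) :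
    D.ContractsTo s r x r :=
  (contractsTo_iff hs hD hr hx).2 (.inr (.inl ⟨h, rfl⟩))

theorem exists_contractsTo {x : V} (hx : x ∈ D.verts) : ∃ y, D.ContractsTo s r x y := by
  by_cases h : D.Dominates s r x
  · by_cases hd : D.depth s x ≤ D.depth s r + 3
    · exact ⟨x, (contractsTo_iff hs hD hr hx).2 (.inl ⟨h, hd, rfl⟩)⟩
    · obtain ⟨y, h₁, h₂, h₃⟩ := h.exists_depth_eq hs hD (n := D.depth s r + 3) (by omega) (by omega)
      exact ⟨y, (contractsTo_iff hs hD hr hx).2 (.inr (.inr ⟨h₁, h₃, h₂⟩))⟩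
  · exact ⟨r, contractsTo_of_not_dominates hs hD hr hx h⟩

/-- The clauses overlap only for a vertex of level 3, which is both kept and contracted into itself.
-/
theorem ContractsTo.unique {x y z : V} (hx : x ∈ D.verts) (hy : D.ContractsTo s r x y)
    (hz : D.ContractsTo s r x z) : y = z := by
  rw [contractsTo_iff hs hD hr hx] at hy hz
  rcases hy with ⟨h₁, h₂, rfl⟩ | ⟨h₁, rfl⟩ | ⟨h₁, h₂, h₃⟩ <;>
    rcases hz with ⟨h₁', h₂', rfl⟩ | ⟨h₁', rfl⟩ | ⟨h₁', h₂', h₃'⟩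
  · rfl
  · exact absurd h₁ h₁'
  · exact (h₃'.eq_of_depth_le hs hD (by omega)).symm
  · exact absurd h₁' h₁
  · rfl
  · exact absurd (h₁'.trans h₃') h₁
  · exact h₃.eq_of_depth_le hs hD (by omega)
  · exact absurd (h₁.trans h₃) h₁'
  · exact h₃.eq_of_depth_eq hs hD h₃' (by omega)

/-- The image of a walk in the auxiliary graph. -/
theorem Conn.auxGraph {P Q : V → Prop} {u w u' w' : V} (h : D.Conn P u w)
    (hPQ : ∀ z ∈ D.verts, P z → ∀ y, D.ContractsTo s r z y → Q y)
    (hu : D.ContractsTo s r u u') (hw : D.ContractsTo s r w w') :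
    (D.auxGraph s r).Conn Q u' w' := by
  refine h.induction_right (motive := fun w => ∀ w', D.ContractsTo s r w w' →
    (D.auxGraph s r).Conn Q u' w') ?_ ?_ w' hw
  · intro h₁ h₂ w' hw'
    rw [← hu.unique hs hD hr h₁ hw']
    exact .refl hu.mem (hPQ _ h₁ h₂ _ hu)
  · intro a b h₀ h₁ h₂ ih b' hb'
    obtain ⟨a', ha'⟩ := exists_contractsTo hs hD hr h₀.right.1
    -- An edge inside one contracted class would be a loop and is skipped.
    by_cases hab : a' = b'
    · exact hab ▸ ih a' ha'
    · exact (ih a' ha').tail ⟨hab, a, b, h₁, ha', hb'⟩ (hPQ _ (D.right_mem h₁) h₂ _ hb')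

theorem auxGraph_stronglyConnected : (D.auxGraph s r).StronglyConnected :=
  .of_conn fun _ hu _ hw =>
    (hD.conn (auxVerts_subset hs hD hr hu) (auxVerts_subset hs hD hr hw)).auxGraph hs hD hr
      (fun _ _ _ _ _ => trivial) (contractsTo_self hu) (contractsTo_self hw)

/-- A walk that avoids a vertex of the auxiliary graph corresponds to a walk of the auxiliary graph
that avoids this vertex. -/
theorem Conn.auxGraph_ne {u w x : V} (h : D.Conn (· ≠ x) u w) (hu : u ∈ D.auxVerts s r)
    (hw : w ∈ D.auxVerts s r) (hx : x ∈ D.auxVerts s r) :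
    (D.auxGraph s r).Conn (· ≠ x) u w := by
  -- The walk has to avoid the whole class of `x`, not only `x` itself.
  suffices H : D.Conn (fun z => ¬ D.ContractsTo s r z x) u w from
    H.auxGraph hs hD hr (by rintro z - hz y hy rfl; exact hz hy)
      (contractsTo_self hu) (contractsTo_self hw)
  have hu' := (mem_auxVerts_iff hs hD hr).1 hu
  have hw' := (mem_auxVerts_iff hs hD hr).1 hw
  have hx' := (mem_auxVerts_iff hs hD hr).1 hx
  -- The class of `r` contains the non-descendants of `r`. Read backwards from `w`, a walk avoiding
  -- `r` never leaves the descendants of `r`.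
  by_cases hxr : x = r
  · subst hxr
    have : D.Conn (fun z => z ≠ x ∧ D.Dominates s x z) u w := by
      have key : D.Dominates s x u ∧ D.Conn (fun z => z ≠ x ∧ D.Dominates s x z) u w := by
        refine h.induction_left
          (motive := fun u => D.Dominates s x u ∧ D.Conn (fun z => z ≠ x ∧ D.Dominates s x z) u w)
          (fun h₁ h₂ => ⟨hw'.1, .refl h₁ ⟨h₂, hw'.1⟩⟩) ?_
        rintro a b h₁ h₂ h₃ ⟨ih₁, ih₂⟩
        have := ih₁.of_adj h₁ ih₂.1.2.1.symm
        exact ⟨this, .head h₁ ⟨h₂, this⟩ ih₂⟩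
      exact key.2
    refine this.mono fun z hz h h' => ?_
    rw [contractsTo_iff hs hD hr hz] at h'
    rcases h' with ⟨-, -, rfl⟩ | ⟨h', -⟩ | ⟨-, h', -⟩
    · exact h.1 rfl
    · exact h' h.2
    · omega
  -- At level 3 the class is the set of descendants of `x`, which can be entered only at `x`; at
  -- levels 1 and 2 it is `x` alone.
  · by_cases hd : D.depth s x = D.depth s r + 3
    · have hxu : ¬ D.Dominates s x u := fun h' =>
        h.1.2 (h'.eq_of_depth_le hs hD (by omega)).symm
      have : D.Conn (fun z => ¬ D.Dominates s x z) u w := by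
        refine h.induction_right (fun h₁ _ => .refl h₁ hxu) fun a b h₀ h₁ h₂ ih => ?_
        exact ih.tail h₁ fun h' => ih.right.2 (h'.of_adj h₁ h₂.symm)
      refine this.mono fun z hz h h' => ?_
      rw [contractsTo_iff hs hD hr hz] at h'
      rcases h' with ⟨-, -, rfl⟩ | ⟨-, h'⟩ | ⟨-, -, h'⟩
      · exact h (.refl hz)
      · exact hxr h'
      · exact h h'
    · refine h.mono fun z hz h h' => ?_
      rw [contractsTo_iff hs hD hr hz] at h'
      rcases h' with ⟨-, -, rfl⟩ | ⟨-, h'⟩ | ⟨-, h', -⟩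
      · exact h rfl
      · exact hxr h'
      · exact hd h'

/-- A walk of the auxiliary graph that avoids `y` lifts to a walk that avoids a given vertex that
is contracted into `y`. -/
theorem Conn.of_auxGraph_ne {a b x y : V} (h : (D.auxGraph s r).Conn (· ≠ y) a b)
    (hx : D.ContractsTo s r x y) (hxD : x ∈ D.verts) : D.Conn (· ≠ x) a b := by
  have ne_of : ∀ {z d}, D.ContractsTo s r z d → d ≠ y → z ≠ x := by
    rintro z d hz hd rfl
    exact hd (hz.unique hs hD hr hxD hx)
  refine h.induction_right ?_ ?_
  · exact fun h₁ h₂ =>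
      .refl (auxVerts_subset hs hD hr h₁) (ne_of (contractsTo_self h₁) h₂)
  -- The edge from `c` to `d` comes from one from `u` to `v`. It remains to join `c` to `u` inside
  -- the class of `c`, and `v` to `d` inside that of `d`.
  rintro c d h₀ ⟨hcd, u, v, huv, hu, hv⟩ hdy ih
  have hcy : c ≠ y := h₀.right.2
  have hvx := ne_of hv hdy
  have huD := D.left_mem huv
  have hvD := D.right_mem huv
  -- an edge that enters the set of the descendants of `r` starts at `r` or inside
  have hrv : D.Dominates s r v → v ≠ r → D.Dominates s r u := fun h h' => h.of_adj huv h'.symm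
  have h₁ : D.Conn (· ≠ x) c u := by
    have hu' := (contractsTo_iff hs hD hr huD).1 hu
    rcases hu' with ⟨-, -, rfl⟩ | ⟨hu', rfl⟩ | ⟨-, hc, hu'⟩
    · exact .refl huD (ne_of hu hcy)
    -- A non-descendant of `r` can enter the descendants only at `r`, so the edge would be a loop at
    -- `r`.
    · exfalso
      have hv' := (contractsTo_iff hs hD hr hvD).1 hv
      rcases hv' with ⟨hv', -, rfl⟩ | ⟨-, hv'⟩ | ⟨hv', hd, hv''⟩
      · exact hu' (hrv hv' hcd.symm)
      · exact hcd hv'.symm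
      · refine hu' (hrv (hv'.trans hv'') ?_)
        rintro rfl
        have := hv''.depth_le hs hD
        omega
    · have hcr := (mem_auxVerts_iff hs hD hr).1 hu.mem
      refine (hu'.conn_within hs hD).mono fun z hz hcz => ?_
      exact ne_of ((contractsTo_iff hs hD hr hz).2 (.inr (.inr ⟨hcr.1, hc, hcz⟩))) hcy
  have h₂ : D.Conn (· ≠ x) v d := by
    have hv' := (contractsTo_iff hs hD hr hvD).1 hv
    rcases hv' with ⟨-, -, rfl⟩ | ⟨hv', rfl⟩ | ⟨hd, hd', hv'⟩
    · exact .refl hvD hvx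
    · refine (conn_of_not_dominates hD hr hvD hv').mono fun z hz h => ?_
      rcases h with rfl | h
      · exact ne_of (contractsTo_self (root_mem_auxVerts hs hD hr)) hdy
      · exact ne_of (contractsTo_of_not_dominates hs hD hr hz h) hdy
    -- The class of a level-3 vertex `d` is entered only at `d`; otherwise `u` would lie in the same
    -- class.
    · by_cases hdv : d = v
      · rw [hdv]
        exact .refl hvD hvx
      · exfalso
        have := hv'.of_adj huv hdv
        exact hcd (hu.unique hs hD hr huD
          ((contractsTo_iff hs hD hr huD).2 (.inr (.inr ⟨hd, hd', this⟩))))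
  exact ih.trans (h₁.trans ((Conn.refl hvD hvx).head huv h₁.right.2 |>.trans h₂))

theorem sameSCC_auxGraph_remove {u w x : V} (h : (D.remove x).SameSCC u w)
    (hu : u ∈ D.auxVerts s r) (hw : w ∈ D.auxVerts s r) (hx : x ∈ D.auxVerts s r) :
    ((D.auxGraph s r).remove x).SameSCC u w := by
  rw [sameSCC_remove_iff] at h ⊢
  exact ⟨h.1.auxGraph_ne hs hD hr hu hw hx, h.2.auxGraph_ne hs hD hr hw hu hx⟩

theorem sameSCC_remove_of_auxGraph {a b x y : V}
    (h : ((D.auxGraph s r).remove y).SameSCC a b) (hx : D.ContractsTo s r x y)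
    (hxD : x ∈ D.verts) : (D.remove x).SameSCC a b := by
  rw [sameSCC_remove_iff] at h ⊢
  exact ⟨h.1.of_auxGraph_ne hs hD hr hx hxD, h.2.of_auxGraph_ne hs hD hr hx hxD⟩

theorem VertexResilient.auxGraph {u w : V} (h : D.VertexResilient u w)
    (hu : u ∈ D.auxVerts s r) (hw : w ∈ D.auxVerts s r) :
    (D.auxGraph s r).VertexResilient u w := fun x hx h₁ h₂ =>
  sameSCC_auxGraph_remove hs hD hr (h x (auxVerts_subset hs hD hr hx) h₁ h₂) hu hw hx

/-- Ordinary vertices that are vertex-resilient in the auxiliary graph are vertex-resilient. -/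
theorem VertexResilient.of_auxGraph {u w : V} (h : (D.auxGraph s r).VertexResilient u w)
    (hu : u ∈ D.ordinary s r) (hw : w ∈ D.ordinary s r) : D.VertexResilient u w := by
  -- Nothing else is contracted into an ordinary vertex. For `r = s` this holds because `s` has no
  -- non-descendants.
  have key : ∀ {a x y}, a ∈ D.ordinary s r → x ∈ D.verts → D.ContractsTo s r x y → x ≠ a →
      y ≠ a := by
    rintro a x y ha hx hxy hxa rfl
    obtain ⟨h₁, h₂⟩ := (mem_ordinary_iff hs hD hr).1 ha
    rcases (contractsTo_iff hs hD hr hx).1 hxy with ⟨-, -, rfl⟩ | ⟨h₃, rfl⟩ | ⟨-, h₃, -⟩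
    · exact hxa rfl
    · rcases h₂ with h₂ | h₂ | ⟨rfl, -⟩
      · omega
      · omega
      · exact h₃ (.root hs hx)
    · rcases h₂ with h₂ | h₂ | ⟨rfl, rfl⟩ <;> omega
  intro x hx hxu hxw
  obtain ⟨y, hy⟩ := exists_contractsTo hs hD hr hx
  exact sameSCC_remove_of_auxGraph hs hD hr
    (h y hy.mem (key hu hx hy hxu) (key hw hx hy hxw)) hy hx

/-- A set `B` of siblings, possibly with their parent `p`, that contains two vertices of the auxiliary
graph of `r` consists of vertices of this auxiliary graph. -/
theorem dominates_and_subset_auxVerts {p : V} {B : Set V} (hB : B ⊆ D.closedChildren s p)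
    (h : (B ∩ D.auxVerts s r).Nontrivial) : D.Dominates s r p ∧ B ⊆ D.auxVerts s r := by
  obtain ⟨a, ⟨haB, ha⟩, hap⟩ := h.exists_ne p
  have hpa : D.IsIDom s p a := (hB haB).resolve_left hap
  obtain ⟨h₁, h₂⟩ := (mem_auxVerts_iff hs hD hr).1 ha
  have hrp : D.Dominates s r p := by
    -- Two different witnesses are used: `b ≠ r` forces `p` below `r`, while the child `a ≠ p`
    -- bounds the depth of all of `B`.
    obtain ⟨b, ⟨hbB, hb⟩, hbr⟩ := h.exists_ne r
    have hb' := ((mem_auxVerts_iff hs hD hr).1 hb).1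
    rcases hB hbB with rfl | hpb
    · exact hb'
    · exact IsIDom.of_dominates hpb hb' hbr.symm
  refine ⟨hrp, fun b hb => (mem_auxVerts_iff hs hD hr).2 ?_⟩
  have hd := hpa.depth_eq hs hD
  rcases hB hb with rfl | hb
  · exact ⟨hrp, by omega⟩
  · have := IsIDom.depth_eq hs hD hb
    exact ⟨hrp.trans (IsIDom.dominates hb), by omega⟩

end

theorem SameSCC.symm {D : VDigraph V} {u v : V} (h : D.SameSCC u v) : D.SameSCC v u := ⟨h.2, h.1⟩

theorem SameSCC.trans {D : VDigraph V} {u v w : V} (h : D.SameSCC u v) (h' : D.SameSCC v w) :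
    D.SameSCC u w := by
  rw [sameSCC_iff] at *
  exact ⟨h.1.trans h'.1, h'.2.trans h.2⟩

theorem SameSCC.refl {D : VDigraph V} {u : V} (h : u ∈ D.verts) : D.SameSCC u u :=
  sameSCC_iff.2 ⟨.refl h trivial, .refl h trivial⟩

theorem eq_of_mem_sccs {D : VDigraph V} {S S' : Set V} {a : V} (hS : S ∈ D.sccs)
    (hS' : S' ∈ D.sccs) (ha : a ∈ S) (ha' : a ∈ S') : S = S' := by
  obtain ⟨v, -, rfl⟩ := hS
  obtain ⟨v', -, rfl⟩ := hS'
  ext w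
  exact ⟨fun h => (ha'.trans ha.symm).trans h, fun h => (ha.trans ha'.symm).trans h⟩

/-- `B` is contained in the closed set of children of some vertex. -/
def IsFlat (D : VDigraph V) (s : V) (B : Set V) : Prop := ∃ p ∈ D.verts, B ⊆ D.closedChildren s p

end VDigraph

/-! ### Invariants of the block family and the effect of single steps -/

namespace FastVRB

open VDigraph

variable {V : Type*}

/-- Every set of `F'` is contained in some set of `F`. -/
def Refines (F' F : Set (Set V)) : Prop := ∀ B' ∈ F', ∃ B ∈ F, B' ⊆ B

theorem Refines.refl (F : Set (Set V)) : Refines F F := fun B hB => ⟨B, hB, subset_rfl⟩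

theorem Refines.trans {F F' F'' : Set (Set V)} (h : Refines F'' F') (h' : Refines F' F) :
    Refines F'' F := by
  intro B hB
  obtain ⟨B', hB', h₁⟩ := h B hB
  obtain ⟨B'', hB'', h₂⟩ := h' B' hB'
  exact ⟨B'', hB'', h₁.trans h₂⟩

/-- The properties of the current set of blocks that are maintained by the algorithm. -/
structure IsBlockFamily (D : VDigraph V) (s : V) (F : Set (Set V)) : Prop where
  nontrivial : ∀ B ∈ F, B.Nontrivial
  eq_of_inter : ∀ B ∈ F, ∀ B' ∈ F, (B ∩ B').Nontrivial → B = B'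
  isFlat : ∀ B ∈ F, D.IsFlat s B
  exists_superset : ∀ C ⊆ D.verts, C.Nontrivial → C.Pairwise D.VertexResilient → ∃ B ∈ F, C ⊆ B

/-- The vertices of `S` in the same set of `F` are vertex-resilient. -/
def Resolved (D : VDigraph V) (F : Set (Set V)) (S : Set V) : Prop :=
  ∀ B ∈ F, (B ∩ S).Pairwise D.VertexResilient

/-- Steps only shrink blocks, so what is resolved once stays resolved; the other `of_refines` lemmas
serve the same purpose. -/
theorem Resolved.of_refines {D : VDigraph V} {F F' : Set (Set V)} {S : Set V}
    (h : Resolved D F S) (hF : Refines F' F) : Resolved D F' S := by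
  intro B' hB'
  obtain ⟨B, hB, hsub⟩ := hF B' hB'
  exact (h B hB).mono (Set.inter_subset_inter_left _ hsub)

/-- A set of `F` with two vertices of the flow graph `HR(r)` consists of such vertices and is
contained in a closed set of children of the dominator tree. -/
def FlatWithin (HR : VDigraph V) (r : V) (F : Set (Set V)) : Prop :=
  ∀ B ∈ F, (B ∩ HR.verts).Nontrivial → B ⊆ HR.verts ∧ HR.IsFlat r B

theorem FlatWithin.of_refines {HR : VDigraph V} {r : V} {F F' : Set (Set V)}
    (h : FlatWithin HR r F) (hF : Refines F' F) : FlatWithin HR r F' := by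
  intro B' hB' hnt
  obtain ⟨B, hB, hsub⟩ := hF B' hB'
  obtain ⟨h₁, p, hp, h₂⟩ := h B hB (hnt.mono (Set.inter_subset_inter_left _ hsub))
  exact ⟨hsub.trans h₁, p, hp, hsub.trans h₂⟩

/-- The sets of `F` with two ordinary vertices of the auxiliary graph of `q` do not meet two
strongly connected components of this graph without `q`. -/
def RefinedAt (HR : VDigraph V) (r : V) (F : Set (Set V)) (q : V) : Prop :=
  ∀ B ∈ F, (B ∩ HR.ordinary r q).Nontrivial → ∀ a ∈ B, a ≠ q → ∀ b ∈ B, b ≠ q →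
    ((HR.auxGraph r q).remove q).SameSCC a b

theorem RefinedAt.of_refines {HR : VDigraph V} {r q : V} {F F' : Set (Set V)}
    (h : RefinedAt HR r F q) (hF : Refines F' F) : RefinedAt HR r F' q := by
  intro B' hB' hnt a ha haq b hb hbq
  obtain ⟨B, hB, hsub⟩ := hF B' hB'
  exact h B hB (hnt.mono (Set.inter_subset_inter_left _ hsub)) a (hsub ha) haq b (hsub hb) hbq

theorem mem_splitStep {D : VDigraph V} {s r : V} {F : Set (Set V)} {A : Set V} :
    A ∈ splitStep D s r F ↔ (A ∈ F ∧ ¬ (A ∩ D.children s r).Nonempty) ∨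
      ∃ B ∈ F, (B ∩ D.children s r).Nonempty ∧ ∃ p ∈ (D.auxGraph s r).verts,
        A = B ∩ (D.auxGraph s r).reverse.closedChildren r p ∧ A.Nontrivial := by
  simp only [splitStep, split, Set.mem_union, Set.mem_sdiff, Set.mem_ofPred_eq, reverse]
  constructor
  · rintro (⟨h, h'⟩ | ⟨B, ⟨h₁, h₂⟩, h₃⟩)
    · exact .inl ⟨h, fun h'' => h' ⟨h, h''⟩⟩
    · exact .inr ⟨B, h₁, h₂, h₃⟩
  · rintro (⟨h, h'⟩ | ⟨B, h₁, h₂, h₃⟩)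
    · exact .inl ⟨h, fun h'' => h' h''.2⟩
    · exact .inr ⟨B, ⟨h₁, h₂⟩, h₃⟩

theorem mem_refineStep {HR : VDigraph V} {r q : V} {F : Set (Set V)} {A : Set V} :
    A ∈ refineStep HR r F q ↔ (A ∈ F ∧ ¬ (A ∩ HR.ordinary r q).Nontrivial) ∨
      ∃ B ∈ F, (B ∩ HR.ordinary r q).Nontrivial ∧ ∃ S ∈ ((HR.auxGraph r q).remove q).sccs,
        A = B ∩ (S ∪ {q}) ∧ A.Nontrivial := by
  simp only [refineStep, refineBlocks, Set.mem_union, Set.mem_sdiff, Set.mem_ofPred_eq]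
  constructor
  · rintro (⟨h, h'⟩ | ⟨B, ⟨h₁, h₂⟩, h₃⟩)
    · exact .inl ⟨h, fun h'' => h' ⟨h, h''⟩⟩
    · exact .inr ⟨B, h₁, h₂, h₃⟩
  · rintro (⟨h, h'⟩ | ⟨B, h₁, h₂, h₃⟩)
    · exact .inl ⟨h, fun h'' => h' h''.2⟩
    · exact .inr ⟨B, ⟨h₁, h₂⟩, h₃⟩

theorem splitStep_refines (D : VDigraph V) (s r : V) (F : Set (Set V)) :
    Refines (splitStep D s r F) F := by
  intro A hA
  rcases mem_splitStep.1 hA with ⟨h, -⟩ | ⟨B, hB, -, p, -, rfl, -⟩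
  · exact ⟨A, h, subset_rfl⟩
  · exact ⟨B, hB, Set.inter_subset_left⟩

theorem refineStep_refines (HR : VDigraph V) (r : V) (F : Set (Set V)) (q : V) :
    Refines (refineStep HR r F q) F := by
  intro A hA
  rcases mem_refineStep.1 hA with ⟨h, -⟩ | ⟨B, hB, -, S, -, rfl, -⟩
  · exact ⟨A, h, subset_rfl⟩
  · exact ⟨B, hB, Set.inter_subset_left⟩

theorem foldl_refineStep_refines (HR : VDigraph V) (r : V) (qs : List V) (F : Set (Set V)) :
    Refines (qs.foldl (refineStep HR r) F) F := by
  induction qs generalizing F with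
  | nil => exact .refl F
  | cons q qs ih => exact (ih _).trans (refineStep_refines HR r F q)

theorem process_refines (D : VDigraph V) (s r : V) (qs : List V) (F : Set (Set V)) :
    Refines (process D s r qs F) F :=
  (foldl_refineStep_refines _ _ _ _).trans (splitStep_refines D s r F)

theorem refineStep_refinedAt (HR : VDigraph V) (r : V) (F : Set (Set V)) (q : V) :
    RefinedAt HR r (refineStep HR r F q) q := by
  intro A hA hnt a ha haq b hb hbq
  rcases mem_refineStep.1 hA with ⟨-, h⟩ | ⟨B, -, -, S, ⟨v, -, rfl⟩, rfl, -⟩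
  · exact absurd hnt h
  · exact (ha.2.resolve_right haq).symm.trans (hb.2.resolve_right hbq)

/-- The order is irrelevant: the property is created when `q` is processed and survives all later
refinements. -/
theorem foldl_refineStep_refinedAt (HR : VDigraph V) (r : V) (qs : List V) (F : Set (Set V))
    {q : V} (hq : q ∈ qs) : RefinedAt HR r (qs.foldl (refineStep HR r) F) q := by
  induction qs generalizing F with
  | nil => simp at hq
  | cons q' qs ih =>
    rcases List.mem_cons.1 hq with rfl | hq
    · exact (refineStep_refinedAt HR r F q).of_refines (foldl_refineStep_refines HR r qs _)
    · exact ih _ hq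

/-- A set of the family that has been refined at all non-leaves of the dominator tree of `H^R(r)`
is not separated by a vertex that dominates one of its members in `H^R(r)`. -/
theorem sameSCC_of_refinedAt [Finite V] {HR : VDigraph V} {r : V}
    {F : Set (Set V)} (hrT : r ∈ HR.verts) (hHR : HR.StronglyConnected)
    (href : ∀ q ∈ HR.nonLeaves r, RefinedAt HR r F q) {B : Set V} (hB : B ∈ F)
    (hflat : HR.IsFlat r B) {a b x : V} (ha : a ∈ B) (hb : b ∈ B) (hab : a ≠ b) (hxa : x ≠ a)
    (hxb : x ≠ b) (hx : HR.Dominates r x a) : (HR.remove x).SameSCC a b := by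
  obtain ⟨p, hp, hBp⟩ := hflat
  have hxp : HR.Dominates r x p := by
    rcases hBp ha with rfl | h
    · exact hx
    · exact IsIDom.of_dominates h hx hxa
  -- For `x = p` both vertices are children of `p`, and the refinement at `p` applies. Otherwise the
  -- refinement at the parent `q` of `p` applies: `B` lies in its levels 1 and 2, and `x` is
  -- contracted into `q`.
  by_cases hxeq : x = p
  · subst hxeq
    have ha' : HR.IsIDom r x a := (hBp ha).resolve_left (Ne.symm hxa)
    have hb' : HR.IsIDom r x b := (hBp hb).resolve_left (Ne.symm hxb)
    have hord : ∀ {c}, HR.IsIDom r x c → c ∈ HR.ordinary r x := fun h =>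
      (mem_ordinary_iff hrT hHR hp).2 ⟨h.dominates, .inl (h.depth_eq hrT hHR)⟩
    exact sameSCC_remove_of_auxGraph hrT hHR hp (href x ⟨a, ha'⟩ B hB
      ⟨a, ⟨ha, hord ha'⟩, b, ⟨hb, hord hb'⟩, hab⟩ a ha (Ne.symm hxa) b hb (Ne.symm hxb))
      (contractsTo_self (root_mem_auxVerts hrT hHR hp)) hp
  · obtain ⟨q, hqp⟩ := exists_isIDom hrT hHR hp fun h => hxeq (by subst h; exact hxp.eq_root)
    have hq := hqp.dominates.1
    have hxq := hqp.of_dominates hxp hxeq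
    have hdq := hqp.depth_eq hrT hHR
    have hord : ∀ {c}, c ∈ B → c ∈ HR.ordinary r q ∧ c ≠ q := by
      intro c hc
      rcases hBp hc with rfl | h
      · exact ⟨(mem_ordinary_iff hrT hHR hq).2 ⟨hqp.dominates, .inl hdq⟩, hqp.ne.symm⟩
      · have := IsIDom.depth_eq hrT hHR h
        refine ⟨(mem_ordinary_iff hrT hHR hq).2 ⟨hqp.dominates.trans (IsIDom.dominates h),
          .inr (.inl (by omega))⟩, ?_⟩
        rintro rfl
        omega
    refine sameSCC_remove_of_auxGraph hrT hHR hq (href q ⟨p, hqp⟩ B hB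
      ⟨a, ⟨ha, (hord ha).1⟩, b, ⟨hb, (hord hb).1⟩, hab⟩ a ha (hord ha).2 b hb (hord hb).2)
      ?_ hxq.1
    by_cases hxq' : x = q
    · subst hxq'
      exact contractsTo_self (root_mem_auxVerts hrT hHR hq)
    · exact contractsTo_of_not_dominates hrT hHR hq hxq.1 fun h =>
        hxq' (hxq.antisymm hrT hHR h)

/-! ### Preservation of the invariants and correctness of one iteration -/

section

variable [Finite V] {D : VDigraph V} {s r : V} {F : Set (Set V)} (hs : s ∈ D.verts)
  (hD : D.StronglyConnected)

include hs hD

theorem isBlockFamily_initialBlocks : IsBlockFamily D s (initialBlocks D s) where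
  nontrivial := by
    rintro B ⟨v, ⟨w, hw⟩, rfl⟩
    exact ⟨v, .inl rfl, w, .inr hw, IsIDom.ne hw⟩
  eq_of_inter := by
    rintro B ⟨v, -, rfl⟩ B' ⟨v', -, rfl⟩ h
    rw [eq_of_nontrivial_inter_closedChildren hs hD h]
  isFlat := by
    rintro B ⟨v, ⟨w, hw⟩, rfl⟩
    exact ⟨v, (IsIDom.dominates hw).1, subset_rfl⟩
  exists_superset := by
    intro C hC hnt hvr
    obtain ⟨p, hp, h⟩ := exists_subset_closedChildren hs hD hC hnt hvr
    exact ⟨_, ⟨p, hp, rfl⟩, h⟩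

/-- When all vertex pairs within the closed sets of children are resolved, the family consists of
the vertex-resilient blocks. -/
theorem IsBlockFamily.eq_vrBlocks (hF : IsBlockFamily D s F)
    (hres : ∀ r ∈ D.nonLeaves s, Resolved D F (D.ordinary s r)) : F = D.vrBlocks := by
  have hsub : ∀ B ∈ F, B ⊆ D.verts := by
    intro B hB b hb
    obtain ⟨p, hp, h⟩ := hF.isFlat B hB
    rcases h hb with rfl | h
    · exact hp
    · exact (IsIDom.dominates h).2.1
  have hvr : ∀ B ∈ F, B.Pairwise D.VertexResilient := by
    intro B hB
    obtain ⟨p, hp, h⟩ := hF.isFlat B hB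
    obtain ⟨c, hc, hcp⟩ := (hF.nontrivial B hB).exists_ne p
    have hpc : D.IsIDom s p c := (h hc).resolve_left hcp
    -- The parent of `p` works, since `B` then occupies its levels 1 and 2. The root has no parent,
    -- which is why `s` is ordinary for itself.
    obtain ⟨r, hr, hBr⟩ : ∃ r ∈ D.nonLeaves s, B ⊆ D.ordinary s r := by
      by_cases hps : p = s
      · subst hps
        refine ⟨p, ⟨c, hpc⟩, fun b hb => (mem_ordinary_iff hs hD hp).2 ?_⟩
        rcases h hb with rfl | hb
        · exact ⟨.refl hp, .inr (.inr ⟨rfl, rfl⟩)⟩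
        · exact ⟨IsIDom.dominates hb, .inl (IsIDom.depth_eq hs hD hb)⟩
      · obtain ⟨r, hr⟩ := exists_isIDom hs hD hp hps
        refine ⟨r, ⟨p, hr⟩, fun b hb => (mem_ordinary_iff hs hD hr.dominates.1).2 ?_⟩
        have hd := hr.depth_eq hs hD
        rcases h hb with rfl | hb
        · exact ⟨hr.dominates, .inl hd⟩
        · have := IsIDom.depth_eq hs hD hb
          exact ⟨hr.dominates.trans (IsIDom.dominates hb), .inr (.inl (by omega))⟩
    have := hres r hr B hB
    rwa [Set.inter_eq_left.2 hBr] at this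
  have hmax : ∀ B ∈ F, ∀ C ⊆ D.verts, C.Pairwise D.VertexResilient → B ⊆ C → C ⊆ B := by
    intro B hB C hC hCvr hBC
    obtain ⟨B', hB', hCB'⟩ := hF.exists_superset C hC ((hF.nontrivial B hB).mono hBC) hCvr
    have : B = B' := hF.eq_of_inter B hB B' hB' (by
      rw [Set.inter_eq_left.2 (hBC.trans hCB')]
      exact hF.nontrivial B hB)
    exact this ▸ hCB'
  ext B
  constructor
  · intro hB
    exact ⟨⟨⟨hsub B hB, hvr B hB⟩, fun C hC hBC => hmax B hB C hC.1 hC.2 hBC⟩, hF.nontrivial B hB⟩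
  · rintro ⟨hB, hnt⟩
    obtain ⟨B', hB', hBB'⟩ := hF.exists_superset B hB.1.1 hnt hB.1.2
    have := hB.2 ⟨hsub B' hB', hvr B' hB'⟩ hBB'
    exact Set.Subset.antisymm hBB' this ▸ hB'

variable (hr : r ∈ D.verts)

include hr

theorem auxGraph_reverse_stronglyConnected : (D.auxGraph s r).reverse.StronglyConnected :=
  (auxGraph_stronglyConnected hs hD hr).reverse

theorem root_mem_auxGraph_reverse : r ∈ (D.auxGraph s r).reverse.verts :=
  root_mem_auxVerts hs hD hr

theorem pairwise_auxGraph_reverse {C : Set V} (hC : C ⊆ D.auxVerts s r)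
    (hvr : C.Pairwise D.VertexResilient) :
    C.Pairwise (D.auxGraph s r).reverse.VertexResilient := fun _ ha _ hb hab =>
  ((hvr ha hb hab).auxGraph hs hD hr (hC ha) (hC hb)).reverse

theorem isFlat_auxGraph_reverse {C : Set V} (hC : C ⊆ D.auxVerts s r) (hnt : C.Nontrivial)
    (hvr : C.Pairwise D.VertexResilient) :
    (D.auxGraph s r).reverse.IsFlat r C := by
  obtain ⟨p, ⟨w, hw⟩, h⟩ := exists_subset_closedChildren (root_mem_auxGraph_reverse hs hD hr)
    (auxGraph_reverse_stronglyConnected hs hD hr) hC hnt (pairwise_auxGraph_reverse hs hD hr hC hvr)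
  exact ⟨p, (IsIDom.dominates hw).1, h⟩

theorem IsBlockFamily.subset_auxVerts (hF : IsBlockFamily D s F) {B : Set V} (hB : B ∈ F)
    (h : (B ∩ D.auxVerts s r).Nontrivial) : B ⊆ D.auxVerts s r := by
  obtain ⟨p, -, hp⟩ := hF.isFlat B hB
  exact (dominates_and_subset_auxVerts hs hD hr hp h).2

/-- Such a block hangs below `r` or below the given child, so it stays within two levels of `r`. -/
theorem IsBlockFamily.subset_auxVerts_of_children (hF : IsBlockFamily D s F) {B : Set V}
    (hB : B ∈ F) (h : (B ∩ D.children s r).Nonempty) : B ⊆ D.auxVerts s r := by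
  obtain ⟨p, hp, hBp⟩ := hF.isFlat B hB
  obtain ⟨c, hcB, hc⟩ := h
  have hd := IsIDom.depth_eq hs hD hc
  have hrp : D.Dominates s r p ∧ D.depth s p ≤ D.depth s r + 1 := by
    rcases hBp hcB with rfl | hpc
    · exact ⟨IsIDom.dominates hc, hd.le⟩
    · rw [IsIDom.unique hs hD hpc hc]
      exact ⟨.refl hr, by omega⟩
  intro b hb
  refine (mem_auxVerts_iff hs hD hr).2 ?_
  rcases hBp hb with rfl | hpb
  · exact ⟨hrp.1, by omega⟩
  · have := IsIDom.depth_eq hs hD hpb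
    exact ⟨hrp.1.trans (IsIDom.dominates hpb), by omega⟩

theorem IsBlockFamily.splitStep (hF : IsBlockFamily D s F) :
    IsBlockFamily D s (splitStep D s r F) where
  nontrivial := by
    intro A hA
    rcases mem_splitStep.1 hA with ⟨h, -⟩ | ⟨B, -, -, p, -, rfl, h⟩
    · exact hF.nontrivial A h
    · exact h
  eq_of_inter := by
    intro A hA A' hA' hnt
    rcases mem_splitStep.1 hA with ⟨h₁, h₂⟩ | ⟨B, h₁, h₂, p, -, rfl, -⟩ <;>
      rcases mem_splitStep.1 hA' with ⟨h₁', h₂'⟩ | ⟨B', h₁', h₂', p', -, rfl, -⟩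
    · exact hF.eq_of_inter A h₁ A' h₁' hnt
    · have := hF.eq_of_inter A h₁ B' h₁'
        (hnt.mono (Set.inter_subset_inter_right _ Set.inter_subset_left))
      exact absurd (this ▸ h₂') h₂
    · have := hF.eq_of_inter B h₁ A' h₁'
        (hnt.mono (Set.inter_subset_inter_left _ Set.inter_subset_left))
      exact absurd (this ▸ h₂) h₂'
    · rw [hF.eq_of_inter B h₁ B' h₁' (hnt.mono
          (Set.inter_subset_inter Set.inter_subset_left Set.inter_subset_left)),
        eq_of_nontrivial_inter_closedChildren (root_mem_auxGraph_reverse hs hD hr)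
          (auxGraph_reverse_stronglyConnected hs hD hr) (hnt.mono
          (Set.inter_subset_inter Set.inter_subset_right Set.inter_subset_right))]
  isFlat := by
    intro A hA
    obtain ⟨B, hB, hAB⟩ := splitStep_refines D s r F A hA
    obtain ⟨p, hp, h⟩ := hF.isFlat B hB
    exact ⟨p, hp, hAB.trans h⟩
  exists_superset := by
    intro C hC hnt hvr
    obtain ⟨B, hB, hCB⟩ := hF.exists_superset C hC hnt hvr
    by_cases h : (B ∩ D.children s r).Nonempty
    · obtain ⟨p, hp, hCp⟩ := isFlat_auxGraph_reverse hs hD hr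
        (hCB.trans (hF.subset_auxVerts_of_children hs hD hr hB h)) hnt hvr
      have hsub := Set.subset_inter hCB hCp
      exact ⟨_, mem_splitStep.2 (.inr ⟨B, hB, h, p, hp, rfl, hnt.mono hsub⟩), hsub⟩
    · exact ⟨B, mem_splitStep.2 (.inl ⟨hB, h⟩), hCB⟩

/-- After the splits, the sets of the family are compatible with the dominator tree of `H^R(r)`. -/
theorem IsBlockFamily.flatWithin_splitStep (hF : IsBlockFamily D s F)
    (hres : ∀ v ∈ D.nonLeaves s, D.Dominates s r v → v ≠ r → Resolved D F (D.ordinary s v)) :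
    FlatWithin (D.auxGraph s r).reverse r (FastVRB.splitStep D s r F) := by
  intro A hA hnt
  rcases mem_splitStep.1 hA with ⟨h₁, h₂⟩ | ⟨B, h₁, h₂, p, hp, rfl, -⟩
  -- An unsplit block without children of `r` belongs to the ordinary vertices of a proper
  -- descendant of `r`. It is already resolved there, hence flat in the dominator tree of `H^R(r)`.
  · have hsub : A ⊆ D.auxVerts s r := hF.subset_auxVerts hs hD hr h₁ hnt
    refine ⟨hsub, isFlat_auxGraph_reverse hs hD hr hsub (hF.nontrivial A h₁) ?_⟩
    obtain ⟨v, hv, hAv⟩ := hF.isFlat A h₁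
    have hrv := (dominates_and_subset_auxVerts hs hD hr hAv hnt).1
    obtain ⟨c, hc, hcv⟩ := (hF.nontrivial A h₁).exists_ne v
    have hvc : D.IsIDom s v c := (hAv hc).resolve_left hcv
    have hvr : v ≠ r := by
      rintro rfl
      exact h₂ ⟨c, hc, hvc⟩
    suffices ∃ u ∈ D.nonLeaves s, D.Dominates s r u ∧ u ≠ r ∧ A ⊆ D.ordinary s u by
      obtain ⟨u, hu, hru, hur, hAu⟩ := this
      have := hres u hu hru hur A h₁
      rwa [Set.inter_eq_left.2 hAu] at this
    obtain ⟨u, huv⟩ := exists_isIDom hs hD hv fun hvs =>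
      hvr (by subst hvs; exact hrv.eq_root.symm)
    have hdu := huv.depth_eq hs hD
    -- If the parent of `v` is `r` itself, then `v` is a child of `r` and so is not in `A`. Thus `A`
    -- consists of children of `v`, and `v` serves in place of `u`.
    by_cases hur : u = r
    · subst hur
      refine ⟨v, ⟨c, hvc⟩, hrv, hvr, fun b hb => (mem_ordinary_iff hs hD hv).2 ?_⟩
      rcases hAv hb with rfl | hb'
      · exact absurd ⟨b, hb, huv⟩ h₂
      · exact ⟨IsIDom.dominates hb', .inl (IsIDom.depth_eq hs hD hb')⟩
    · refine ⟨u, ⟨v, huv⟩, huv.of_dominates hrv hvr.symm, hur, fun b hb =>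
        (mem_ordinary_iff hs hD huv.dominates.1).2 ?_⟩
      rcases hAv hb with rfl | hb'
      · exact ⟨huv.dominates, .inl hdu⟩
      · have := IsIDom.depth_eq hs hD hb'
        exact ⟨huv.dominates.trans (IsIDom.dominates hb'), .inr (.inl (by omega))⟩
  · exact ⟨Set.inter_subset_left.trans (hF.subset_auxVerts_of_children hs hD hr h₁ h₂), p, hp,
      Set.inter_subset_right⟩

theorem IsBlockFamily.refineStep (hF : IsBlockFamily D s F)
    (hflat : FlatWithin (D.auxGraph s r).reverse r F) {q : V}
    (hq : q ∈ (D.auxGraph s r).reverse.verts) :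
    IsBlockFamily D s (refineStep (D.auxGraph s r).reverse r F q) where
  nontrivial := by
    intro A hA
    rcases mem_refineStep.1 hA with ⟨h, -⟩ | ⟨B, -, -, S, -, rfl, h⟩
    · exact hF.nontrivial A h
    · exact h
  eq_of_inter := by
    intro A hA A' hA' hnt
    rcases mem_refineStep.1 hA with ⟨h₁, h₂⟩ | ⟨B, h₁, h₂, S, hS, rfl, -⟩ <;>
      rcases mem_refineStep.1 hA' with ⟨h₁', h₂'⟩ | ⟨B', h₁', h₂', S', hS', rfl, -⟩
    · exact hF.eq_of_inter A h₁ A' h₁' hnt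
    · have := hF.eq_of_inter A h₁ B' h₁'
        (hnt.mono (Set.inter_subset_inter_right _ Set.inter_subset_left))
      exact absurd (this ▸ h₂') h₂
    · have := hF.eq_of_inter B h₁ A' h₁'
        (hnt.mono (Set.inter_subset_inter_left _ Set.inter_subset_left))
      exact absurd (this ▸ h₂) h₂'
    · obtain ⟨a, ⟨⟨-, ha⟩, -, ha'⟩, haq⟩ := hnt.exists_ne q
      rw [hF.eq_of_inter B h₁ B' h₁' (hnt.mono
          (Set.inter_subset_inter Set.inter_subset_left Set.inter_subset_left)),
        eq_of_mem_sccs hS hS' (ha.resolve_right haq) (ha'.resolve_right haq)]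
  isFlat := by
    intro A hA
    obtain ⟨B, hB, hAB⟩ := refineStep_refines _ r F q A hA
    obtain ⟨p, hp, h⟩ := hF.isFlat B hB
    exact ⟨p, hp, hAB.trans h⟩
  exists_superset := by
    intro C hC hnt hvr
    obtain ⟨B, hB, hCB⟩ := hF.exists_superset C hC hnt hvr
    by_cases h : (B ∩ (D.auxGraph s r).reverse.ordinary r q).Nontrivial
    · have hrT := root_mem_auxGraph_reverse hs hD hr
      have hHR := auxGraph_reverse_stronglyConnected hs hD hr
      have hord := ordinary_subset_auxVerts hrT hHR hq
      -- Flatness puts all of `B` into the second-level graph. Without this, intersecting with its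
      -- components could lose members of `C`.
      obtain ⟨hBH, p, hp, hBp⟩ := hflat B hB (h.mono (Set.inter_subset_inter_right _
        (hord.trans (auxVerts_subset hrT hHR hq))))
      have hBK := (dominates_and_subset_auxVerts hrT hHR hq hBp
        (h.mono (Set.inter_subset_inter_right _ hord))).2
      have hvr' := pairwise_auxGraph_reverse hs hD hr (hCB.trans hBH) hvr
      obtain ⟨c, hc, hcq⟩ := hnt.exists_ne q
      have hcK : c ∈ (((D.auxGraph s r).reverse.auxGraph r q).remove q).verts :=
        ⟨hBK (hCB hc), hcq⟩
      have hsub : C ⊆ B ∩ ({w | (((D.auxGraph s r).reverse.auxGraph r q).remove q).SameSCC c w} ∪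
          {q}) := by
        refine fun b hb => ⟨hCB hb, ?_⟩
        by_cases hbq : b = q
        · exact .inr hbq
        by_cases hbc : b = c
        · subst hbc
          exact .inl (.refl hcK)
        · exact .inl (sameSCC_auxGraph_remove hrT hHR hq
            (hvr' hc hb (Ne.symm hbc) q hq (Ne.symm hcq) (Ne.symm hbq)) (hBK (hCB hc))
            (hBK (hCB hb)) (root_mem_auxVerts hrT hHR hq))
      exact ⟨_, mem_refineStep.2 (.inr ⟨B, hB, h, _, ⟨c, hcK, rfl⟩, rfl, hnt.mono hsub⟩), hsub⟩
    · exact ⟨B, mem_refineStep.2 (.inl ⟨hB, h⟩), hCB⟩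

theorem IsBlockFamily.foldl_refineStep (hF : IsBlockFamily D s F)
    (hflat : FlatWithin (D.auxGraph s r).reverse r F) {qs : List V}
    (hqs : ∀ q ∈ qs, q ∈ (D.auxGraph s r).reverse.verts) :
    IsBlockFamily D s (qs.foldl (FastVRB.refineStep (D.auxGraph s r).reverse r) F) := by
  induction qs generalizing F with
  | nil => exact hF
  | cons q qs ih =>
    exact ih (hF.refineStep hs hD hr hflat (hqs q (by simp)))
      (hflat.of_refines (refineStep_refines _ r F q)) fun q' hq' => hqs q' (by simp [hq'])

/-- At the end of the iteration for `r`, all pairs of ordinary vertices are resolved. -/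
theorem IsBlockFamily.resolved_of_refinedAt (hF : IsBlockFamily D s F)
    (hres : ∀ v ∈ D.nonLeaves s, D.Dominates s r v → v ≠ r → Resolved D F (D.ordinary s v))
    (hflat : FlatWithin (D.auxGraph s r).reverse r F)
    (href : ∀ q ∈ (D.auxGraph s r).reverse.nonLeaves r,
      RefinedAt (D.auxGraph s r).reverse r F q) :
    Resolved D F (D.ordinary s r) := by
  rintro B hB a ⟨ha, har⟩ b ⟨hb, hbr⟩ hab
  have hord := ordinary_subset_auxVerts hs hD hr
  have hrT := root_mem_auxGraph_reverse hs hD hr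
  have hHR := auxGraph_reverse_stronglyConnected hs hD hr
  obtain ⟨hBH, hBflat⟩ := hflat B hB ⟨a, ⟨ha, hord har⟩, b, ⟨hb, hord hbr⟩, hab⟩
  obtain ⟨v, hv, hBv⟩ := hF.isFlat B hB
  -- Siblings below a proper descendant of `r` were settled when that descendant was processed.
  by_cases hdone : v ≠ r ∧ D.Dominates s r v ∧ D.IsIDom s v a ∧ D.IsIDom s v b
  · obtain ⟨hvr, hrv, hva, hvb⟩ := hdone
    have hmem : ∀ {c}, D.IsIDom s v c → c ∈ D.ordinary s v := fun h =>
      (mem_ordinary_iff hs hD hv).2 ⟨h.dominates, .inl (h.depth_eq hs hD)⟩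
    exact hres v ⟨a, hva⟩ hrv hvr B hB ⟨ha, hmem hva⟩ ⟨hb, hmem hvb⟩ hab
  refine VertexResilient.of_auxGraph hs hD hr (fun x hx hxa hxb => ?_) har hbr
  rw [← sameSCC_remove_reverse]
  by_cases hxTa : (D.auxGraph s r).reverse.Dominates r x a
  · exact sameSCC_of_refinedAt hrT hHR href hB hBflat ha hb hab hxa hxb hxTa
  by_cases hxTb : (D.auxGraph s r).reverse.Dominates r x b
  · exact (sameSCC_of_refinedAt hrT hHR href hB hBflat hb ha hab.symm hxb hxa hxTb).symm
  have hxr : x ≠ r := by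
    rintro rfl
    exact hxTa (.root hrT (hBH ha))
  have hrx := ((mem_auxVerts_iff hs hD hr).1 hx).1
  have hdx := hrx.depth_lt hs hD hxr.symm
  -- Both `x` and `v` lie strictly below `r`. If `v` were one of the pair, then `x ≠ v` would put
  -- `v` at level 2 or deeper and its child at level 3 or deeper, which is not ordinary. So both are
  -- children of `v`, contrary to `hdone`.
  have key : ∀ {c d}, c ∈ B → c ∈ D.ordinary s r → d ∈ B → d ∈ D.ordinary s r → c ≠ d → x ≠ c →
      x ≠ d → D.Dominates s x c →
      v ≠ r ∧ D.Dominates s r v ∧ D.IsIDom s v c ∧ D.IsIDom s v d := by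
    intro c d hc hcr hd hdr hcd hxc hxd hxdom
    have hxv : D.Dominates s x v := by
      rcases hBv hc with rfl | h
      · exact hxdom
      · exact IsIDom.of_dominates h hxdom hxc
    have hdxv := hxv.depth_le hs hD
    have hchild : ∀ {e}, D.IsIDom s v e → e ∈ D.ordinary s r → D.depth s v < D.depth s r + 2 := by
      intro e he her
      have := he.depth_eq hs hD
      rcases ((mem_ordinary_iff hs hD hr).1 her).2 with h | h | ⟨h, -⟩
      · omega
      · omega
      · exact absurd h he.ne_root
    have hself : v ∈ D.ordinary s r → x ≠ v → D.depth s r + 2 ≤ D.depth s v := by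
      intro hvr hne
      have := hxv.depth_lt hs hD hne
      rcases ((mem_ordinary_iff hs hD hr).1 hvr).2 with h | h | ⟨h, -⟩
      · omega
      · omega
      · exact absurd ((h ▸ hxv : D.Dominates s x s).eq_root.trans h.symm) hne
    refine ⟨?_, hrx.trans hxv, ?_⟩
    · rintro rfl
      omega
    rcases hBv hc with hcv | hcv <;> rcases hBv hd with hdv | hdv
    · exact absurd (hcv.trans hdv.symm) hcd
    · have h₁ := hchild hdv hdr
      have h₂ := hself (hcv ▸ hcr) (hcv ▸ hxc)
      omega
    · have h₁ := hchild hcv hcr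
      have h₂ := hself (hdv ▸ hdr) (hdv ▸ hxd)
      omega
    · exact ⟨hcv, hdv⟩
  have hxDa : ¬ D.Dominates s x a := fun h =>
    hdone (key ha har hb hbr hab hxa hxb h)
  have hxDb : ¬ D.Dominates s x b := fun h => by
    obtain ⟨h₁, h₂, h₃, h₄⟩ := key hb hbr ha har hab.symm hxb hxa h
    exact hdone ⟨h₁, h₂, h₄, h₃⟩
  -- Non-dominance in D(s) gives walks from `r`; non-dominance in H^R(r) gives walks to `r`. The
  -- pair is connected through `r` in both directions.
  have hfrom : ∀ {c}, c ∈ D.auxVerts s r → ¬ D.Dominates s x c →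
      (D.auxGraph s r).Conn (· ≠ x) r c := by
    intro c hc hxc
    have hrc := ((mem_auxVerts_iff hs hD hr).1 hc).1
    have : D.Conn (· ≠ x) s c := by
      by_contra h
      exact hxc (dominates_iff.2 ⟨hrx.2.1, hrc.2.1, h⟩)
    exact (hrc.conn this).2.auxGraph_ne hs hD hr (root_mem_auxVerts hs hD hr) hc hx
  have hto : ∀ {c}, c ∈ D.auxVerts s r → ¬ (D.auxGraph s r).reverse.Dominates r x c →
      (D.auxGraph s r).Conn (· ≠ x) c r := by
    intro c hc hxc
    have : (D.auxGraph s r).reverse.Conn (· ≠ x) r c := by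
      by_contra h
      exact hxc (dominates_iff.2 ⟨hx, hc, h⟩)
    exact this.reverse
  rw [sameSCC_remove_reverse, sameSCC_remove_iff]
  exact ⟨(hto (hBH ha) hxTa).trans (hfrom (hBH hb) hxDb),
    (hto (hBH hb) hxTb).trans (hfrom (hBH ha) hxDa)⟩

theorem IsBlockFamily.process (hF : IsBlockFamily D s F)
    (hres : ∀ v ∈ D.nonLeaves s, D.Dominates s r v → v ≠ r → Resolved D F (D.ordinary s v))
    {qs : List V} (hqs : EnumeratesNonLeaves (D.auxGraph s r).reverse r qs) :
    IsBlockFamily D s (process D s r qs F) ∧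
      Resolved D (FastVRB.process D s r qs F) (D.ordinary s r) := by
  have hflat := hF.flatWithin_splitStep hs hD hr hres
  have hmem : ∀ q ∈ qs, q ∈ (D.auxGraph s r).reverse.verts := by
    intro q hq
    obtain ⟨w, hw⟩ := (hqs.2 q).1 hq
    exact (IsIDom.dominates hw).1
  have hF' := (hF.splitStep hs hD hr).foldl_refineStep hs hD hr hflat hmem
  refine ⟨hF', hF'.resolved_of_refinedAt hs hD hr ?_ ?_ ?_⟩
  · exact fun v hv h₁ h₂ => (hres v hv h₁ h₂).of_refines (process_refines D s r qs F)
  · exact hflat.of_refines (foldl_refineStep_refines _ _ _ _)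
  · exact fun q hq => foldl_refineStep_refinedAt _ r qs _ ((hqs.2 q).2 hq)

end

/-! ### Whole executions and their existence -/

theorem exists_enumeratesNonLeaves [Finite V] (D : VDigraph V) (s : V) :
    ∃ qs, EnumeratesNonLeaves D s qs :=
  ⟨(Set.toFinite (D.nonLeaves s)).toFinset.toList, Finset.nodup_toList _, by simp⟩

section

variable [Finite V] {D : VDigraph V} {s : V} (hs : s ∈ D.verts) (hD : D.StronglyConnected)

include hs hD

/-- The loop invariant is that every non-leaf no longer waiting in the list is resolved. Bottom-up
order ensures that the proper descendants of the next vertex are among these. -/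
theorem IsBlockFamily.foldl_process {F : Set (Set V)} (hF : IsBlockFamily D s F) {rs : List V}
    {qs : V → List V} (hrs : ∀ r ∈ rs, r ∈ D.nonLeaves s) (hup : BottomUp D s rs)
    (hqs : ∀ r ∈ rs, EnumeratesNonLeaves (D.auxGraph s r).reverse r (qs r))
    (hres : ∀ v ∈ D.nonLeaves s, v ∉ rs → Resolved D F (D.ordinary s v)) :
    rs.foldl (fun F r => FastVRB.process D s r (qs r) F) F = D.vrBlocks := by
  induction rs generalizing F with
  | nil => exact hF.eq_vrBlocks hs hD fun r hr => hres r hr (by simp)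
  | cons r rs ih =>
    obtain ⟨hup₁, hup₂⟩ := List.pairwise_cons.1 hup
    have hr : r ∈ D.verts := by
      obtain ⟨w, hw⟩ := hrs r (by simp)
      exact (IsIDom.dominates hw).1
    obtain ⟨h₁, h₂⟩ := hF.process hs hD hr (fun v hv hrv hne => hres v hv (by
      rw [List.mem_cons, not_or]
      exact ⟨hne, fun hmem => hup₁ v hmem ((isAncestor_iff hs hD hrv.2.1).2 hrv)⟩))
      (hqs r (by simp))
    refine ih h₁ (fun v hv => hrs v (by simp [hv])) hup₂ (fun v hv => hqs v (by simp [hv])) ?_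
    intro v hv hvrs
    by_cases hvr : v = r
    · exact hvr ▸ h₂
    · exact (hres v hv (by simp [hvr, hvrs])).of_refines (process_refines D s r (qs r) F)

theorem Outputs.eq_vrBlocks {O : Set (Set V)} (h : Outputs D s O) : O = D.vrBlocks := by
  obtain ⟨rs, qs, hrs, hup, hqs, rfl⟩ := h
  exact (isBlockFamily_initialBlocks hs hD).foldl_process hs hD (fun r hr => (hrs.2 r).1 hr) hup hqs
    fun v hv hv' => absurd ((hrs.2 v).2 hv) hv'

/-- Sorting by decreasing depth works: an ancestor that is at least as deep as its descendant equals
it, which the absence of duplicates excludes. -/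
theorem exists_bottomUp : ∃ rs, EnumeratesNonLeaves D s rs ∧ BottomUp D s rs := by
  classical
  let le : V → V → Prop := fun a b => D.depth s b ≤ D.depth s a
  have : Std.Total le := ⟨fun a b => le_total _ _⟩
  have : IsTrans V le := ⟨fun a b c h h' => le_trans h' h⟩
  let l := (Set.toFinite (D.nonLeaves s)).toFinset.toList
  have hnd : (l.insertionSort le).Nodup := (List.perm_insertionSort le l).nodup_iff.2
    (Finset.nodup_toList _)
  have hmem : ∀ v, v ∈ l.insertionSort le ↔ v ∈ D.nonLeaves s := by
    simp [l, (List.perm_insertionSort le _).mem_iff]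
  refine ⟨l.insertionSort le, ⟨hnd, hmem⟩, ?_⟩
  refine ((List.pairwise_insertionSort le l).and hnd).imp_of_mem ?_
  rintro a b - hb ⟨h₁, h₂⟩ h
  obtain ⟨w, hw⟩ := (hmem b).1 hb
  exact h₂ (((isAncestor_iff hs hD (IsIDom.dominates hw).1).1 h).eq_of_depth_le hs hD h₁)

theorem exists_outputs : ∃ O, Outputs D s O := by
  obtain ⟨rs, h₁, h₂⟩ := exists_bottomUp hs hD
  choose qs hqs using fun r => exists_enumeratesNonLeaves (D.auxGraph s r).reverse r
  exact ⟨_, rs, qs, h₁, h₂, fun r _ => hqs r, rfl⟩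

end

end FastVRB

theorem mainTheorem8 {V : Type*} [Finite V] (G : Digraph V)
    (hG : (VDigraph.ofDigraph G).StronglyConnected) (s : V) (O : Set (Set V)) :
    FastVRB.Outputs (VDigraph.ofDigraph G) s O ↔ O = (VDigraph.ofDigraph G).vrBlocks := by
  have hs : s ∈ (VDigraph.ofDigraph G).verts := Set.mem_univ s
  refine ⟨fun h => h.eq_vrBlocks hs hG, ?_⟩
  rintro rfl
  -- Some execution exists, and its output is forced to be the set of blocks.
  obtain ⟨O, hO⟩ := FastVRB.exists_outputs hs hG
  exact hO.eq_vrBlocks hs hG ▸ hO
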